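/- Let $k$ be an algebraically closed field, and let $n \ge 1$, $d \ge 2$ and $s \ge 1$ be integers. Let $\operatorname{End}^n_d$ be the space of degree-$d$ endomorphisms of $\mathbb{P}^n$ over $k$, that is, the set of points $f = (f_0 : \dots : f_n)$ of the projective space of $(n+1)$-tuples of degree-$d$ forms in $n+1$ variables such that $f_0, \dots, f_n$ have no common zero in $\mathbb{P}^n$, and let $$\operatorname{End}^n_d(s) = \{(f,P) \in \operatorname{End}^n_d \times \mathbb{P}^n : f^s(P) = P\},$$ where $f^s$ is the $s$-th iterate of $f$. Give $\operatorname{End}^n_d$ and $\operatorname{End}^n_d \times \mathbb{P}^n$ (and their subsets) the Zariski topology. Then $\operatorname{End}^n_d(s)$ is a closed subset of $\operatorname{End}^n_d \times \mathbb{P}^n$, and it is pure of dimension $N = \dim \operatorname{End}^n_d$: it has dimension $N$, and each of its irreducible components has dimension $N$. -/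

import Mathlib

open scoped LinearAlgebra.Projectivization

namespace EndDyn

/-! ### The Zariski topology on a projective space and on a product of two projective spaces -/

section Zariski

variable {k : Type*} [Field k] {ι κ : Type*}

/-- `p` is bihomogeneous of bidegree `e = (a, b)`: every monomial of `p` has degree `a` in the
variables indexed by `ι` and degree `b` in the variables indexed by `κ`. -/
def IsBihomogeneous (p : MvPolynomial (ι ⊕ κ) k) (e : ℕ × ℕ) : Prop :=
  MvPolynomial.IsWeightedHomogeneous
    (Sum.elim (fun _ => ((1, 0) : ℕ × ℕ)) (fun _ => ((0, 1) : ℕ × ℕ))) p e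

theorem eval_smul_of_isHomogeneous {p : MvPolynomial ι k} {a : ℕ} (hp : p.IsHomogeneous a)
    (c : k) (v : ι → k) :
    MvPolynomial.eval (c • v) p = c ^ a * MvPolynomial.eval v p := by
  rw [MvPolynomial.eval_eq, MvPolynomial.eval_eq, Finset.mul_sum]
  refine Finset.sum_congr rfl fun m hm => ?_
  have h : m.degree = a := by
    rw [Finsupp.degree_eq_weight_one]
    exact hp (MvPolynomial.mem_support_iff.mp hm)
  have h2 : ∑ i ∈ m.support, m i = a := h
  simp only [Pi.smul_apply, smul_eq_mul, mul_pow, Finset.prod_mul_distrib,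
    Finset.prod_pow_eq_pow_sum, h2]
  ring

/-- The zero locus in projective space of a set of polynomials (in practice homogeneous ones, for
which the choice of homogeneous coordinates `P.rep` of the point `P` does not matter). -/
def projZeros (S : Set (MvPolynomial ι k)) : Set (ℙ k (ι → k)) :=
  {P | ∀ p ∈ S, MvPolynomial.eval P.rep p = 0}

/-- Vanishing of a homogeneous polynomial at a point of projective space may be tested on any
homogeneous coordinates of the point. -/
theorem eval_rep_mk_eq_zero_iff {p : MvPolynomial ι k} {a : ℕ} (hp : p.IsHomogeneous a)
    (v : ι → k) (hv : v ≠ 0) :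
    MvPolynomial.eval (Projectivization.mk k v hv).rep p = 0 ↔ MvPolynomial.eval v p = 0 := by
  obtain ⟨c, hc⟩ := Projectivization.exists_smul_eq_mk_rep k v hv
  have h : (c : k) • v = (Projectivization.mk k v hv).rep := hc
  rw [← h, eval_smul_of_isHomogeneous hp]
  simp

/-- The Zariski topology on projective space: the closed sets are the zero loci of sets of
homogeneous polynomials. -/
instance zariskiProj : TopologicalSpace (ℙ k (ι → k)) :=
  TopologicalSpace.ofClosed
    {C | ∃ S : Set (MvPolynomial ι k), (∀ p ∈ S, ∃ a, p.IsHomogeneous a) ∧ C = projZeros S}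
    ⟨{1}, by
      refine ⟨?_, ?_⟩
      · rintro p rfl
        exact ⟨0, MvPolynomial.isHomogeneous_one ι k⟩
      · ext P
        simp [projZeros]⟩
    (by
      intro A hA
      refine ⟨{p | (∃ a, p.IsHomogeneous a) ∧
        ∃ C ∈ A, ∀ P ∈ C, MvPolynomial.eval P.rep p = 0}, fun p hp => hp.1, ?_⟩
      ext P
      constructor
      · rintro hP p ⟨-, C, hC, h⟩
        exact h P (hP C hC)
      · intro hP C hC
        obtain ⟨S, hS, rfl⟩ := hA hC
        exact fun p hp => hP p ⟨hS p hp, _, hC, fun Q hQ => hQ p hp⟩)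
    (by
      rintro _ ⟨S, hS, rfl⟩ _ ⟨T, hT, rfl⟩
      refine ⟨{r | ∃ p ∈ S, ∃ q ∈ T, r = p * q}, ?_, ?_⟩
      · rintro _ ⟨p, hp, q, hq, rfl⟩
        obtain ⟨a, ha⟩ := hS p hp
        obtain ⟨b, hb⟩ := hT q hq
        exact ⟨a + b, ha.mul hb⟩
      · ext P
        constructor
        · rintro (h | h) _ ⟨p, hp, q, hq, rfl⟩
          · simp [h p hp]
          · simp [h q hq]
        · intro h
          by_contra hcon
          simp only [Set.mem_union, not_or, projZeros, Set.mem_ofPred_eq, not_forall] at hcon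
          obtain ⟨⟨p, hp, hp0⟩, q, hq, hq0⟩ := hcon
          have := h _ ⟨p, hp, q, hq, rfl⟩
          rw [map_mul] at this
          exact (mul_ne_zero hp0 hq0) this)

theorem isClosed_proj_iff (C : Set (ℙ k (ι → k))) :
    IsClosed C ↔ ∃ S : Set (MvPolynomial ι k),
      (∀ p ∈ S, ∃ a, p.IsHomogeneous a) ∧ C = projZeros S := by
  rw [← isOpen_compl_iff]
  change Cᶜᶜ ∈ _ ↔ _
  rw [compl_compl]
  rfl

variable (k ι κ) in
/-- The product of the projective spaces with homogeneous coordinates indexed by `ι` and by `κ`.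
It carries its Zariski topology, not the product topology. -/
structure BiProj where
  /-- the first factor -/
  fst : ℙ k (ι → k)
  /-- the second factor -/
  snd : ℙ k (κ → k)

/-- The value of a polynomial at (chosen homogeneous coordinates of) a point of the product. -/
noncomputable def BiProj.evalRep (x : BiProj k ι κ) (p : MvPolynomial (ι ⊕ κ) k) : k :=
  MvPolynomial.eval (Sum.elim x.fst.rep x.snd.rep) p

/-- The zero locus in a product of two projective spaces of a set of polynomials. -/
def biprojZeros (S : Set (MvPolynomial (ι ⊕ κ) k)) : Set (BiProj k ι κ) :=
  {x | ∀ p ∈ S, x.evalRep p = 0}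

theorem eval_smul_of_isBihomogeneous {p : MvPolynomial (ι ⊕ κ) k} {e : ℕ × ℕ}
    (hp : IsBihomogeneous p e) (c c' : k) (v : ι → k) (w : κ → k) :
    MvPolynomial.eval (Sum.elim (c • v) (c' • w)) p =
      c ^ e.1 * c' ^ e.2 * MvPolynomial.eval (Sum.elim v w) p := by
  rw [MvPolynomial.eval_eq, MvPolynomial.eval_eq, Finset.mul_sum]
  refine Finset.sum_congr rfl fun m hm => ?_
  have h := hp (MvPolynomial.mem_support_iff.mp hm)
  rw [Finsupp.weight_apply, Finsupp.sum] at h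
  have hs : ∀ i : ι ⊕ κ, Sum.elim (c • v) (c' • w) i ^ m i =
      (c ^ (m i • Sum.elim (fun _ => ((1, 0) : ℕ × ℕ)) (fun _ => ((0, 1) : ℕ × ℕ)) i).1 *
        c' ^ (m i • Sum.elim (fun _ => ((1, 0) : ℕ × ℕ)) (fun _ => ((0, 1) : ℕ × ℕ)) i).2) *
        Sum.elim v w i ^ m i := by
    rintro (i | i) <;> simp [mul_pow]
  simp only [hs, Finset.prod_mul_distrib, Finset.prod_pow_eq_pow_sum]
  rw [← Prod.fst_sum, ← Prod.snd_sum, h]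
  ring

/-- Vanishing of a bihomogeneous polynomial at a point of the product may be tested on any
homogeneous coordinates of the point. -/
theorem evalRep_mk_eq_zero_iff {p : MvPolynomial (ι ⊕ κ) k} {e : ℕ × ℕ}
    (hp : IsBihomogeneous p e) (v : ι → k) (hv : v ≠ 0) (w : κ → k) (hw : w ≠ 0) :
    (BiProj.mk (Projectivization.mk k v hv) (Projectivization.mk k w hw)).evalRep p = 0 ↔
      MvPolynomial.eval (Sum.elim v w) p = 0 := by
  obtain ⟨c, hc⟩ := Projectivization.exists_smul_eq_mk_rep k v hv
  obtain ⟨c', hc'⟩ := Projectivization.exists_smul_eq_mk_rep k w hw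
  have h : (c : k) • v = (Projectivization.mk k v hv).rep := hc
  have h' : (c' : k) • w = (Projectivization.mk k w hw).rep := hc'
  rw [BiProj.evalRep, ← h, ← h', eval_smul_of_isBihomogeneous hp]
  simp

/-- The Zariski topology on a product of two projective spaces: the closed sets are the zero loci
of sets of bihomogeneous polynomials. -/
instance zariskiBiProj : TopologicalSpace (BiProj k ι κ) :=
  TopologicalSpace.ofClosed
    {C | ∃ S : Set (MvPolynomial (ι ⊕ κ) k),
      (∀ p ∈ S, ∃ e, IsBihomogeneous p e) ∧ C = biprojZeros S}
    ⟨{1}, by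
      refine ⟨?_, ?_⟩
      · rintro p rfl
        exact ⟨0, MvPolynomial.isWeightedHomogeneous_one k _⟩
      · ext P
        simp [biprojZeros, BiProj.evalRep]⟩
    (by
      intro A hA
      refine ⟨{p | (∃ e, IsBihomogeneous p e) ∧
        ∃ C ∈ A, ∀ x ∈ C, BiProj.evalRep x p = 0}, fun p hp => hp.1, ?_⟩
      ext P
      constructor
      · rintro hP p ⟨-, C, hC, h⟩
        exact h P (hP C hC)
      · intro hP C hC
        obtain ⟨S, hS, rfl⟩ := hA hC
        exact fun p hp => hP p ⟨hS p hp, _, hC, fun Q hQ => hQ p hp⟩)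
    (by
      rintro _ ⟨S, hS, rfl⟩ _ ⟨T, hT, rfl⟩
      refine ⟨{r | ∃ p ∈ S, ∃ q ∈ T, r = p * q}, ?_, ?_⟩
      · rintro _ ⟨p, hp, q, hq, rfl⟩
        obtain ⟨a, ha⟩ := hS p hp
        obtain ⟨b, hb⟩ := hT q hq
        exact ⟨a + b, MvPolynomial.IsWeightedHomogeneous.mul ha hb⟩
      · ext P
        constructor
        · rintro (h | h) _ ⟨p, hp, q, hq, rfl⟩
          · have := h p hp
            simp_all [BiProj.evalRep]
          · have := h q hq
            simp_all [BiProj.evalRep]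
        · intro h
          by_contra hcon
          simp only [Set.mem_union, not_or, biprojZeros, Set.mem_ofPred_eq, not_forall] at hcon
          obtain ⟨⟨p, hp, hp0⟩, q, hq, hq0⟩ := hcon
          have := h _ ⟨p, hp, q, hq, rfl⟩
          rw [BiProj.evalRep, map_mul] at this
          exact (mul_ne_zero hp0 hq0) this)

theorem isClosed_biProj_iff (C : Set (BiProj k ι κ)) :
    IsClosed C ↔ ∃ S : Set (MvPolynomial (ι ⊕ κ) k),
      (∀ p ∈ S, ∃ e, IsBihomogeneous p e) ∧ C = biprojZeros S := by
  rw [← isOpen_compl_iff]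
  change Cᶜᶜ ∈ _ ↔ _
  rw [compl_compl]
  rfl

end Zariski

/-- A topological space is pure of dimension `N` if it has dimension `N` and each of its
irreducible components has dimension `N`. -/
def IsPureOfDim (X : Type*) [TopologicalSpace X] (N : WithBot ℕ∞) : Prop :=
  topologicalKrullDim X = N ∧ ∀ Z ∈ irreducibleComponents X, topologicalKrullDim Z = N

/-! ### Endomorphisms of projective space -/

/-- The exponents `α = (α_0, …, α_n)` of the monomials of degree `d` in `x_0, …, x_n`. -/
abbrev Exponents (n d : ℕ) : Type :=
  {α : Fin (n + 1) →₀ ℕ // α ∈ Finset.finsuppAntidiag Finset.univ d}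

/-- The index set of the coefficients `f_{i, α}` of an `(n + 1)`-tuple of forms of degree `d` in
`n + 1` variables. -/
abbrev CoeffIdx (n d : ℕ) : Type := Fin (n + 1) × Exponents n d

section Endomorphisms

variable {k : Type*} [Field k] {n d : ℕ}

/-- The `i`-th form `f_i = ∑_α f_{i, α} x^α` of the tuple with coefficients `c = (f_{i, α})`. -/
noncomputable def form (c : CoeffIdx n d → k) (i : Fin (n + 1)) : MvPolynomial (Fin (n + 1)) k :=
  ∑ α : Exponents n d, MvPolynomial.monomial α.1 (c (i, α))

theorem form_isHomogeneous (c : CoeffIdx n d → k) (i : Fin (n + 1)) :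
    (form c i).IsHomogeneous d := by
  refine MvPolynomial.IsHomogeneous.sum _ _ _ fun α _ => ?_
  refine MvPolynomial.isHomogeneous_monomial _ ?_
  rw [Finsupp.degree_eq_sum]
  exact (Finset.mem_finsuppAntidiag.mp α.2).1

theorem form_smul (t : k) (c : CoeffIdx n d → k) (i : Fin (n + 1)) :
    form (t • c) i = MvPolynomial.C t * form c i := by
  simp [form, Finset.mul_sum, MvPolynomial.C_mul_monomial]

/-- The vector `(f_0(v), …, f_n(v))`. -/
noncomputable def evalForms (c : CoeffIdx n d → k) (v : Fin (n + 1) → k) : Fin (n + 1) → k :=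
  fun i => MvPolynomial.eval v (form c i)

theorem evalForms_smul_smul (t u : k) (c : CoeffIdx n d → k) (v : Fin (n + 1) → k) :
    evalForms (t • c) (u • v) = (t * u ^ d) • evalForms c v := by
  funext i
  simp [evalForms, form_smul, eval_smul_of_isHomogeneous (form_isHomogeneous c i), mul_assoc]

variable (k n d) in
/-- The space of degree-`d` endomorphisms of projective `n`-space: those points
`(f_0 : … : f_n)` of the projective space of `(n + 1)`-tuples of forms of degree `d` for which
`f_0, …, f_n` have no common zero in projective space. -/
def EndSpace : Set (ℙ k (CoeffIdx n d → k)) :=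
  {f | ∀ v : Fin (n + 1) → k, v ≠ 0 → evalForms f.rep v ≠ 0}

/-- The self-map `P ↦ (f_0(P) : … : f_n(P))` of projective space given by an endomorphism. -/
noncomputable def endMap (f : EndSpace k n d) (P : ℙ k (Fin (n + 1) → k)) :
    ℙ k (Fin (n + 1) → k) :=
  Projectivization.mk k (evalForms f.1.rep P.rep) (f.2 P.rep P.rep_nonzero)

/-- Membership in `EndSpace` does not depend on the choice of homogeneous coordinates. -/
theorem mk_mem_endSpace_iff (c : CoeffIdx n d → k) (hc : c ≠ 0) :
    Projectivization.mk k c hc ∈ EndSpace k n d ↔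
      ∀ v : Fin (n + 1) → k, v ≠ 0 → evalForms c v ≠ 0 := by
  obtain ⟨t, ht⟩ := Projectivization.exists_smul_eq_mk_rep k c hc
  have h : (t : k) • c = (Projectivization.mk k c hc).rep := ht
  have key : ∀ v, evalForms (Projectivization.mk k c hc).rep v = (t : k) • evalForms c v := by
    intro v
    have := evalForms_smul_smul (t : k) 1 c v
    rwa [one_smul, one_pow, mul_one, h] at this
  simp only [EndSpace, Set.mem_ofPred_eq, key]
  simp

/-- `endMap` does not depend on the choices of homogeneous coordinates. -/
theorem endMap_mk (c : CoeffIdx n d → k) (hc : c ≠ 0)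
    (hf : Projectivization.mk k c hc ∈ EndSpace k n d) (v : Fin (n + 1) → k) (hv : v ≠ 0) :
    endMap ⟨Projectivization.mk k c hc, hf⟩ (Projectivization.mk k v hv) =
      Projectivization.mk k (evalForms c v) ((mk_mem_endSpace_iff c hc).mp hf v hv) := by
  obtain ⟨t, ht⟩ := Projectivization.exists_smul_eq_mk_rep k c hc
  obtain ⟨u, hu⟩ := Projectivization.exists_smul_eq_mk_rep k v hv
  have h : (t : k) • c = (Projectivization.mk k c hc).rep := ht
  have h' : (u : k) • v = (Projectivization.mk k v hv).rep := hu
  unfold endMap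
  rw [Projectivization.mk_eq_mk_iff']
  exact ⟨t * u ^ d, by rw [← evalForms_smul_smul, h, h']⟩

variable (k n d) in
/-- The product of `EndSpace k n d` with projective `n`-space. -/
def EndTimesProj : Set (BiProj k (CoeffIdx n d) (Fin (n + 1))) :=
  {x | x.fst ∈ EndSpace k n d}

variable (k n d) in
/-- The incidence variety of pairs `(f, P)`, with `f` a degree-`d` endomorphism of projective
`n`-space and `P` a point, such that `f^s(P) = P`. -/
def Incidence (s : ℕ) : Set (BiProj k (CoeffIdx n d) (Fin (n + 1))) :=
  {x | ∃ hf : x.fst ∈ EndSpace k n d, (endMap ⟨x.fst, hf⟩)^[s] x.snd = x.snd}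

end Endomorphisms

end EndDyn

/-! The projection from the incidence variety to `EndSpace` is closed, maps every irreducible
component onto `EndSpace`, and is quasi-finite in the sense that strictly nested irreducible closed
sets have images with different closures. So for a component `Z`, dim End ≤ dim `Z` ≤ dim Incidence
≤ dim End.

Surjectivity on components is a dimension count upstairs, in affine coordinates. If `F^s(w) = t w`
for a lift `F` of `f`, rescaling `w` by a root of order `d^s - 1` of `t⁻¹` gives `F^s(w) = w`. Hence
the incidence variety is covered by the loci of the minimal primes `Q` of the ideal generated by the
`n + 1` polynomials `F^s_j - X_j` over the coefficient ring `A`. Krull's height theorem gives height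
`Q` ≤ `n + 1`. On the other hand, wherever `F^s` has no nontrivial zero, the equations `F^s(w) = w`
with `d^s ≥ 2` let every monomial of large degree be lowered, so the coordinates are algebraic over
the residue field of `Q ∩ A` (`isIntegral_of_aeval_eq_self`) and height `Q` ≥ height `(Q ∩ A) + n +
1`. Thus `Q ∩ A = 0` (`comap_C_eq_bot_of_mem_minimalPrimes`), and the locus of `Q` dominates
`EndSpace`.

The same algebraicity, at the generic point of the larger of two nested irreducible sets, yields a
polynomial in the coefficients that vanishes on the smaller set but not on the larger
(`closure_incidenceProj_image_ne`). Closedness and the open condition "no common zero" both come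
from one elimination statement, `exists_C_mul_mem_span_of_no_zero`. -/

namespace EndDyn

/-! ### Krull dimension under continuous and closed maps. -/

section Topology

open TopologicalSpace

variable {X Y : Type*} [TopologicalSpace X] [TopologicalSpace Y]

/-- The hypothesis makes the closure of the image strictly monotone on irreducible closed sets, so
chains map to chains of the same length. -/
theorem topologicalKrullDim_le_of_closure_image_ne {f : X → Y} (hf : Continuous f)
    (h : ∀ Z Z' : Set X, IsIrreducible Z → IsClosed Z → IsIrreducible Z' → IsClosed Z' → Z ⊂ Z' →
      closure (f '' Z) ≠ closure (f '' Z')) :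
    topologicalKrullDim X ≤ topologicalKrullDim Y := by
  refine Order.krullDim_le_of_strictMono (IrreducibleCloseds.map f hf) fun Z Z' hlt => ?_
  refine lt_of_le_of_ne ?_ ?_
  · change (IrreducibleCloseds.map f hf Z : Set Y) ⊆ IrreducibleCloseds.map f hf Z'
    rw [IrreducibleCloseds.coe_map, IrreducibleCloseds.coe_map]
    exact closure_mono (Set.image_mono hlt.le)
  · intro heq
    have h1 := congrArg (fun W : IrreducibleCloseds Y => (W : Set Y)) heq
    simp only [IrreducibleCloseds.coe_map] at h1
    exact h Z Z' Z.isIrreducible Z.isClosed Z'.isIrreducible Z'.isClosed hlt h1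

/-- The finitely many irreducible pieces of `C ∩ f⁻¹ W` have closed images covering the irreducible
set `W`, so one image is all of `W`. -/
theorem exists_irreducible_image_eq [NoetherianSpace X] {f : X → Y} (hc : IsClosedMap f)
    (hf : Continuous f) {C : Set X} (hC : IsClosed C) {W : Set Y} (hW : IsClosed W)
    (hWi : IsIrreducible W) (hWC : W ⊆ f '' C) :
    ∃ T ⊆ C, IsClosed T ∧ IsIrreducible T ∧ f '' T = W := by
  classical
  obtain ⟨S, hfin, hcl, hirr, hS⟩ :=
    NoetherianSpace.exists_finite_set_isClosed_irreducible (hC.inter (hW.preimage hf))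
  have hcov : W ⊆ ⋃₀ ((hfin.toFinset.image (fun T => f '' T) : Finset (Set Y)) : Set (Set Y)) := by
    intro y hy
    obtain ⟨x, hx, rfl⟩ := hWC hy
    have hx' : x ∈ ⋃₀ S := hS ▸ ⟨hx, hy⟩
    obtain ⟨T, hT, hxT⟩ := hx'
    exact ⟨f '' T, by simpa using ⟨T, hT, rfl⟩, x, hxT, rfl⟩
  obtain ⟨V, hV, hWV⟩ := isIrreducible_iff_sUnion_isClosed.1 hWi _ (by
    intro V hV
    simp only [Finset.mem_image, Set.Finite.mem_toFinset] at hV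
    obtain ⟨T, hT, rfl⟩ := hV
    exact hc T (hcl T hT)) hcov
  simp only [Finset.mem_image, Set.Finite.mem_toFinset] at hV
  obtain ⟨T, hT, rfl⟩ := hV
  have hTs : T ⊆ C ∩ f ⁻¹' W := hS ▸ Set.subset_sUnion_of_mem hT
  exact ⟨T, fun x hx => (hTs hx).1, hcl T hT, hirr T hT,
    Set.Subset.antisymm (Set.image_subset_iff.2 fun x hx => (hTs hx).2) hWV⟩

/-- A chain below `W` lifts from the top down, each lift being chosen inside the previous one; the
inclusions stay strict because the images differ. -/
theorem height_le_height_of_image_eq [NoetherianSpace X] {f : X → Y} (hc : IsClosedMap f)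
    (hf : Continuous f) (n : ℕ) :
    ∀ (W : IrreducibleCloseds Y) (C : IrreducibleCloseds X), f '' (C : Set X) = W →
      (n : ℕ∞) ≤ Order.height W → (n : ℕ∞) ≤ Order.height C := by
  induction n with
  | zero => intro W C _ _; simp
  | succ n ih =>
    intro W C hCW hn
    obtain ⟨p, hp, hlen⟩ := Order.exists_series_of_le_height W hn
    have hlt : p.eraseLast.last < W := by
      rw [← hp]
      exact p.eraseLast_last_rel_last (by omega)
    have hn' : (n : ℕ∞) ≤ Order.height p.eraseLast.last := by
      have := Order.length_le_height_last (p := p.eraseLast)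
      rw [RelSeries.eraseLast_length, hlen] at this
      simpa using this
    obtain ⟨T, hTC, hTc, hTi, hT⟩ := exists_irreducible_image_eq hc hf C.isClosed
      p.eraseLast.last.isClosed p.eraseLast.last.isIrreducible (hCW ▸ hlt.le)
    have h1 := ih p.eraseLast.last ⟨T, hTi, hTc⟩ hT hn'
    have h2 : (⟨T, hTi, hTc⟩ : IrreducibleCloseds X) < C := by
      refine lt_of_le_of_ne hTC ?_
      rintro rfl
      apply hlt.ne
      ext1
      rw [← hT, ← hCW]
      rfl
    calc ((n + 1 : ℕ) : ℕ∞) = (n : ℕ∞) + 1 := by push_cast; rfl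
      _ ≤ _ := add_le_add_left h1 1
      _ ≤ _ := Order.height_add_one_le h2

theorem topologicalKrullDim_le_of_isClosedMap_of_surjective [NoetherianSpace X] {f : X → Y}
    (hc : IsClosedMap f) (hf : Continuous f) (hs : Function.Surjective f) :
    topologicalKrullDim Y ≤ topologicalKrullDim X := by
  unfold topologicalKrullDim
  rw [Order.krullDim_eq_iSup_height]
  refine iSup_le fun W => ?_
  obtain ⟨T, -, hTc, hTi, hT⟩ := exists_irreducible_image_eq hc hf isClosed_univ
    W.isClosed W.isIrreducible (by rw [Set.image_univ, hs.range_eq]; exact Set.subset_univ _)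
  refine le_trans ?_ (Order.height_le_krullDim (⟨T, hTi, hTc⟩ : IrreducibleCloseds X))
  rw [WithBot.coe_le_coe]
  refine ENat.forall_natCast_le_iff_le.1 fun n hn => ?_
  exact height_le_height_of_image_eq hc hf n W _ hT hn

end Topology

/-! ### Elimination, and integrality of solutions of `G(y) = y`. -/

section Algebra

open MvPolynomial

attribute [local instance] MvPolynomial.gradedAlgebra

variable {R κ : Type*} [CommRing R]

theorem isHomogeneous_span {G : Set (MvPolynomial κ R)} (hG : ∀ g ∈ G, ∃ b, g.IsHomogeneous b) :
    (Ideal.span G).IsHomogeneous (homogeneousSubmodule κ R) :=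
  Ideal.homogeneous_span _ _ fun g hg => hG g hg

theorem homogeneousComponent_mul_of_isHomogeneous (u : MvPolynomial κ R) {g : MvPolynomial κ R}
    {e : ℕ} (hg : g.IsHomogeneous e) {m : ℕ} (hm : e ≤ m) :
    homogeneousComponent m (u * g) = homogeneousComponent (m - e) u * g :=
  (decomposition.decompose'_apply (u * g) m).symm.trans <|
    (DirectSum.coe_decompose_mul_of_right_mem_of_le (homogeneousSubmodule κ R) (a := u) hg
      hm).trans <| congrArg (· * g) (decomposition.decompose'_apply u (m - e))

theorem homogeneousComponent_mul_of_isHomogeneous_of_lt (u : MvPolynomial κ R)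
    {g : MvPolynomial κ R} {e : ℕ} (hg : g.IsHomogeneous e) {m : ℕ} (hm : m < e) :
    homogeneousComponent m (u * g) = 0 :=
  (decomposition.decompose'_apply (u * g) m).symm.trans <|
    DirectSum.coe_decompose_mul_of_right_mem_of_not_le (homogeneousSubmodule κ R) (a := u) hg
      (not_le.2 hm)

theorem homogeneousComponent_map {S : Type*} [CommRing S] (φ : R →+* S) (m : ℕ)
    (p : MvPolynomial κ R) :
    homogeneousComponent m (map φ p) = map φ (homogeneousComponent m p) := by
  ext α
  rw [coeff_homogeneousComponent, coeff_map, coeff_map, coeff_homogeneousComponent]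
  split_ifs <;> simp

/-- Elimination: if a set of forms over `R` has no common nontrivial zero after specialization along
a surjection to an algebraically closed field, then some `r` outside the kernel multiplies all forms
of some fixed degree into the ideal that they generate. -/
theorem exists_C_mul_mem_span_of_no_zero [Finite κ] {k : Type*} [Field k] [IsAlgClosed k]
    (φ : R →+* k) (hφ : Function.Surjective φ) (G : Set (MvPolynomial κ R))
    (hG : ∀ g ∈ G, ∃ b, g.IsHomogeneous b)
    (h0 : ∀ w : κ → k, w ≠ 0 → ∃ g ∈ G, eval w (map φ g) ≠ 0) :
    ∃ (D : ℕ) (r : R), φ r ≠ 0 ∧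
      ∀ h : MvPolynomial κ R, h.IsHomogeneous D → C r * h ∈ Ideal.span G := by
  have hmap : Function.Surjective (map φ : MvPolynomial κ R →+* MvPolynomial κ k) :=
    map_surjective φ hφ
  set I := Ideal.span G
  set J : Ideal (MvPolynomial κ k) := I.map (map φ)
  have hrad : Ideal.span (Set.range (X : κ → MvPolynomial κ k)) ≤ J.radical := by
    rw [Ideal.span_le]
    rintro _ ⟨i, rfl⟩
    rw [SetLike.mem_coe, ← vanishingIdeal_zeroLocus_eq_radical (K := k)]
    intro w hw
    have hw0 : w = 0 := by
      by_contra hne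
      obtain ⟨g, hg, hgw⟩ := h0 w hne
      refine hgw ?_
      have := hw (map φ g) (Ideal.mem_map_of_mem _ (Ideal.subset_span hg))
      rwa [← coe_aeval_eq_eval]
    simp [hw0]
  obtain ⟨D, hD⟩ := Ideal.exists_pow_le_of_le_radical_of_fg hrad
    ⟨(Set.finite_range X).toFinset, by simp⟩
  refine ⟨D, ?_⟩
  -- The Nullstellensatz puts all forms of degree `D` over `k` in the specialized ideal. Lifting
  -- back costs an error with coefficients in `ker φ`; Nakayama then removes it at the price of a
  -- factor `r ≡ 1` modulo `ker φ`.
  have hle : homogeneousSubmodule κ R D ≤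
      I.restrictScalars R ⊔ RingHom.ker φ • homogeneousSubmodule κ R D := by
    intro h hh
    have h1 : map φ h ∈ J := by
      refine hD ?_
      have h2 : (map φ h).IsHomogeneous D := IsHomogeneous.map hh φ
      rw [as_sum (map φ h)]
      refine Ideal.sum_mem _ fun α hα => ?_
      have h3 : α.degree = D := by
        by_contra hne
        exact (mem_support_iff.1 hα) (h2.coeff_eq_zero hne)
      rw [monomial_eq]
      refine Ideal.mul_mem_left _ _ ?_
      rw [← h3, Finsupp.degree_apply, ← Finset.prod_pow_eq_pow_sum]
      exact Ideal.prod_mem_prod fun i _ => Ideal.pow_mem_pow (Ideal.subset_span (Set.mem_range_self i)) _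
    obtain ⟨i, hi, hih⟩ := (Ideal.mem_map_iff_of_surjective _ hmap).1 h1
    have hiD : homogeneousComponent D i ∈ I :=
      homogeneousComponent_mem_of_mem (isHomogeneous_span hG) hi D
    have hz : map φ (h - homogeneousComponent D i) = 0 := by
      rw [map_sub, ← homogeneousComponent_map, hih, homogeneousComponent_map,
        homogeneousComponent_eq_self hh, sub_self]
    have hhom : (h - homogeneousComponent D i).IsHomogeneous D :=
      IsHomogeneous.sub hh (homogeneousComponent_isHomogeneous D i)
    refine Submodule.mem_sup.2 ⟨homogeneousComponent D i, hiD, h - homogeneousComponent D i, ?_,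
      by simp⟩
    rw [as_sum (h - homogeneousComponent D i)]
    refine Submodule.sum_mem _ fun α hα => ?_
    have h3 : α.degree = D := by
      by_contra hne
      exact (mem_support_iff.1 hα) (hhom.coeff_eq_zero hne)
    have h4 : monomial α (coeff α (h - homogeneousComponent D i)) =
        coeff α (h - homogeneousComponent D i) • (monomial α (1 : R)) := by
      rw [smul_monomial, smul_eq_mul, mul_one]
    rw [h4]
    refine Submodule.smul_mem_smul ?_ (isHomogeneous_monomial _ h3)
    rw [RingHom.mem_ker, ← coeff_map, hz, coeff_zero]
  obtain ⟨r, hr, hrle⟩ := Submodule.exists_sub_one_mem_and_smul_le_of_fg_of_le_sup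
    (homogeneousSubmodule_fg κ R D) le_rfl hle
  refine ⟨r, ?_, fun h hh => ?_⟩
  · rw [RingHom.mem_ker, map_sub, map_one, sub_eq_zero] at hr
    simp [hr]
  · rw [← smul_eq_C_mul]
    exact hrle (Submodule.smul_mem_pointwise_smul h r _ hh)

/-- Values at `y` of monomials of bounded degree span a finitely generated `K`-module `V` which
contains 1 and is stable under every `y j`, so the determinant trick applies. -/
theorem isIntegral_of_aeval_eq_self [Finite κ] {K L : Type*} [CommRing K] [Field L] [Algebra R K]
    [Algebra R L] [Algebra K L] [IsScalarTower R K L] {G : κ → MvPolynomial κ R} {e D : ℕ}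
    (he : 2 ≤ e) (hG : ∀ j, (G j).IsHomogeneous e) {r : R} (hr : IsUnit (algebraMap R K r))
    (hD : ∀ h : MvPolynomial κ R, h.IsHomogeneous D → C r * h ∈ Ideal.span (Set.range G))
    {y : κ → L} (hy : ∀ j, aeval y (G j) = y j) (j : κ) : IsIntegral K (y j) := by
  classical
  have := Fintype.ofFinite κ
  set D' := max D 2
  have hfin : {α : κ →₀ ℕ | α.degree < D'}.Finite := by
    refine ((Finset.range D').biUnion fun m =>
      Finset.finsuppAntidiag Finset.univ m).finite_toSet.subset fun α hα => ?_
    simp only [Finset.coe_biUnion, Set.mem_iUnion]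
    refine ⟨α.degree, by simpa using hα, ?_⟩
    simp [Finsupp.degree_eq_sum]
  set V : Submodule K L := Submodule.span K
    ((fun α => aeval y (monomial α (1 : R))) '' {α : κ →₀ ℕ | α.degree < D'})
  have hmono : ∀ (h : MvPolynomial κ R) (m : ℕ), h.IsHomogeneous m →
      (∀ α : κ →₀ ℕ, α.degree = m → aeval y (monomial α (1 : R)) ∈ V) → aeval y h ∈ V := by
    intro h m hh hα
    rw [as_sum h, map_sum]
    refine Submodule.sum_mem _ fun α hα' => ?_
    have h3 : α.degree = m := by
      by_contra hne
      exact (mem_support_iff.1 hα') (hh.coeff_eq_zero hne)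
    have h4 : monomial α (coeff α h) = coeff α h • (monomial α (1 : R)) := by
      rw [smul_monomial, smul_eq_mul, mul_one]
    rw [h4, map_smul, ← algebraMap_smul K]
    exact V.smul_mem _ (hα α h3)
  have hall : ∀ (m : ℕ) (h : MvPolynomial κ R), h.IsHomogeneous m → aeval y h ∈ V := by
    intro m
    induction m using Nat.strong_induction_on with
    | _ m ih =>
      intro h hh
      refine hmono h m hh fun γ hγ => ?_
      by_cases hm : m < D'
      · exact Submodule.subset_span ⟨γ, by simpa [hγ] using hm, rfl⟩
      · obtain ⟨α, hαγ, hα⟩ := Finsupp.exists_le_degree_eq γ D (by omega)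
        obtain ⟨β, rfl⟩ := exists_add_of_le hαγ
        have hmem : C r * monomial (α + β) (1 : R) ∈ Ideal.span (Set.range G) := by
          have : C r * monomial (α + β) (1 : R) =
              monomial β 1 * (C r * monomial α (1 : R)) := by
            rw [mul_left_comm, monomial_mul, mul_one, add_comm β]
          rw [this]
          exact Ideal.mul_mem_left _ _ (hD _ (isHomogeneous_monomial _ hα))
        obtain ⟨u, hu⟩ := (Ideal.mem_span_range_iff_exists_fun).1 hmem
        have hhom : (C r * monomial (α + β) (1 : R)).IsHomogeneous m :=
          (isHomogeneous_monomial _ hγ).C_mul r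
        -- Only the degree `m - e` part of each multiplier contributes. Replacing `G j` by `y j`
        -- turns degree `m` into `m - e + 1`, which is smaller because `e ≥ 2`.
        have key : aeval y (C r * monomial (α + β) (1 : R)) ∈ V := by
          rw [← homogeneousComponent_eq_self hhom, ← hu, map_sum, map_sum]
          refine Submodule.sum_mem _ fun j _ => ?_
          by_cases hem : e ≤ m
          · rw [homogeneousComponent_mul_of_isHomogeneous _ (hG j) hem, map_mul, hy,
              ← aeval_X (R := R) y j, ← map_mul]
            exact ih (m - e + 1) (by omega) _
              ((homogeneousComponent_isHomogeneous _ _).mul (isHomogeneous_X R j))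
          · rw [homogeneousComponent_mul_of_isHomogeneous_of_lt _ (hG j) (by omega), map_zero]
            exact V.zero_mem
        rw [← smul_eq_C_mul, map_smul, ← algebraMap_smul K] at key
        exact (Submodule.smul_mem_iff_of_isUnit V hr).1 key
  have h1 : (1 : L) ∈ V := by simpa using hall 0 1 (isHomogeneous_one κ R)
  refine isIntegral_of_smul_mem_submodule V ?_ ?_ (y j) ?_
  · exact fun hV => one_ne_zero (α := L) ((Submodule.mem_bot K).1 (hV ▸ h1))
  · exact Submodule.fg_span (hfin.image _)
  · intro v hv
    induction hv using Submodule.span_induction with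
    | mem v hv =>
      obtain ⟨α, -, rfl⟩ := hv
      have : y j • aeval y (monomial α (1 : R)) = aeval y (X j * monomial α (1 : R)) := by
        rw [map_mul, aeval_X, smul_eq_mul]
      rw [this]
      exact hall (1 + α.degree) _ ((isHomogeneous_X R j).mul (isHomogeneous_monomial _ rfl))
    | zero => simp
    | add v w _ _ hv hw => rw [smul_add]; exact V.add_mem hv hw
    | smul a v _ hv => rw [smul_comm]; exact V.smul_mem a hv

end Algebra

/-! ### Algebraic relations with coefficients in the ring of definition. -/

section AlgebraicElements

open MvPolynomial

variable {R κ : Type*} [CommRing R]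

/-- Integrality is applied over the fraction field of the image of `R` in `L`, where `r` becomes a
unit. -/
theorem isAlgebraic_range_of_aeval_eq_self [Finite κ] {L : Type*} [Field L]
    [Algebra R L] {G : κ → MvPolynomial κ R} {e D : ℕ}
    (he : 2 ≤ e) (hG : ∀ j, (G j).IsHomogeneous e) {r : R} (hr : algebraMap R L r ≠ 0)
    (hD : ∀ h : MvPolynomial κ R, h.IsHomogeneous D → C r * h ∈ Ideal.span (Set.range G))
    {y : κ → L} (hy : ∀ j, aeval y (G j) = y j) (j : κ) :
    IsAlgebraic (algebraMap R L).range (y j) := by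
  let A := (algebraMap R L).range
  let K := FractionRing A
  let : Algebra K L := FractionRing.liftAlgebra A L
  have : IsScalarTower A K L := inferInstance
  let : Algebra R K := ((algebraMap A K).comp (algebraMap R L).rangeRestrict).toAlgebra
  have : IsScalarTower R K L := IsScalarTower.of_algebraMap_eq fun x => by
    have : algebraMap R K x = algebraMap A K ((algebraMap R L).rangeRestrict x) := rfl
    rw [this, ← IsScalarTower.algebraMap_apply A K L]
    rfl
  rw [IsFractionRing.isAlgebraic_iff A K L]
  refine (isIntegral_of_aeval_eq_self (K := K) he hG (IsUnit.mk0 _ fun h => hr ?_) hD hy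
    j).isAlgebraic
  rw [IsScalarTower.algebraMap_apply R K L, h, map_zero]

theorem exists_polynomial_of_isAlgebraic_range {L : Type*} [Field L] [Algebra R L] {z : L}
    (hz0 : z ≠ 0) (hz : IsAlgebraic (algebraMap R L).range z) :
    ∃ f : Polynomial R, algebraMap R L (f.coeff 0) ≠ 0 ∧ Polynomial.aeval z f = 0 := by
  obtain ⟨q, hq0, hq⟩ := hz.exists_nonzero_coeff_and_aeval_eq_zero
    (mem_nonZeroDivisors_of_ne_zero hz0)
  obtain ⟨f, rfl⟩ := Polynomial.map_surjective _ (algebraMap R L).rangeRestrict_surjective q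
  refine ⟨f, fun h => hq0 ?_, ?_⟩
  · rw [Polynomial.coeff_map]
    exact Subtype.ext h
  · rw [Polynomial.aeval_def, Polynomial.eval₂_map] at hq
    exact hq

end AlgebraicElements

/-! ### Heights of primes in polynomial rings. -/

section Height

-- For `q = Q ∩ R`, going down for the polynomial extension gives height `q` ≤ height `q R[X]`; a
-- strict inclusion of `q R[X]` in `Q` adds one. Iterating over the variables, each algebraic
-- relation modulo `Q` adds one to the height.
variable {R : Type*} [CommRing R]

theorem height_comap_C_add_one_le [IsNoetherianRing R] {Q : Ideal (Polynomial R)} [Q.IsPrime]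
    (hQ : Q ≠ (Q.comap Polynomial.C).map Polynomial.C) :
    (Q.comap Polynomial.C).height + 1 ≤ Q.height := by
  set q := Q.comap Polynomial.C
  have : q.IsPrime := Ideal.comap_isPrime _ _
  have : Q.LiesOver q := ⟨rfl⟩
  have hle : q.map Polynomial.C ≤ Q := Ideal.map_comap_le
  have h1 : q.height ≤ (q.map Polynomial.C).height := by
    have : (q.map Polynomial.C).IsPrime := Ideal.isPrime_map_C_of_isPrime
    have : (q.map Polynomial.C).LiesOver q := ⟨by
      ext x
      simp only [Ideal.under, Ideal.mem_comap, Polynomial.algebraMap_eq, Ideal.mem_map_C_iff,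
        Polynomial.coeff_C]
      exact ⟨fun hx n => by split_ifs <;> simp [hx], fun hx => by simpa using hx 0⟩⟩
    rw [Ideal.height_eq_height_add_of_liesOver_of_hasGoingDown q (q.map Polynomial.C)]
    exact le_self_add
  have : (q.map Polynomial.C).IsPrime := Ideal.isPrime_map_C_of_isPrime
  exact (add_le_add_left h1 1).trans
    (Ideal.height_add_one_le_of_lt_of_isPrime (lt_of_le_of_ne hle hQ.symm))

theorem height_comap_C_add_card_le [IsNoetherianRing R] (m : ℕ)
    (Q : Ideal (MvPolynomial (Fin m) R)) [Q.IsPrime]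
    (hQ : ∀ j, ∃ f : Polynomial R, (∃ i, MvPolynomial.C (f.coeff i) ∉ Q) ∧
      Polynomial.aeval (MvPolynomial.X j) f ∈ Q) :
    (Q.comap MvPolynomial.C).height + m ≤ Q.height := by
  induction m with
  | zero =>
    have : Q.comap MvPolynomial.C = Q.comap (MvPolynomial.isEmptyRingEquiv R (Fin 0)).symm := rfl
    rw [this, RingEquiv.height_comap, Nat.cast_zero, add_zero]
  | succ m ih =>
    let e := MvPolynomial.finSuccEquiv R m
    let Q1 : Ideal (Polynomial (MvPolynomial (Fin m) R)) := Q.comap e.symm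
    have hQ1 : Q1.IsPrime := Ideal.comap_isPrime _ _
    let Q2 := Q1.comap Polynomial.C
    have hQ2 : Q2.IsPrime := Ideal.comap_isPrime _ _
    have heC : ∀ x : R, e.symm (Polynomial.C (MvPolynomial.C x)) = MvPolynomial.C x := fun x =>
      e.symm_apply_eq.2 (by simp [e, MvPolynomial.finSuccEquiv_apply])
    have hC : Q2.comap MvPolynomial.C = Q.comap MvPolynomial.C := by
      ext x
      simp only [Q2, Q1, Ideal.mem_comap]
      rw [← heC x]
    have h2 := ih Q2 fun j => by
      obtain ⟨f, ⟨i, hi⟩, hf⟩ := hQ j.succ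
      refine ⟨f, ⟨i, fun h => hi ?_⟩, ?_⟩
      · exact hC.le h
      · have : e.symm (Polynomial.C (Polynomial.aeval (MvPolynomial.X j) f)) =
            Polynomial.aeval (MvPolynomial.X j.succ) f := by
          rw [e.symm_apply_eq]
          clear hf hi
          induction f using Polynomial.induction_on' with
          | add f g hf hg => simp only [map_add, hf, hg]
          | monomial a x =>
            simp [e, Polynomial.aeval_monomial, MvPolynomial.finSuccEquiv_apply]
        change e.symm (Polynomial.C _) ∈ Q
        rwa [this]
    have h1 : Q2.height + 1 ≤ Q1.height := by
      -- Membership in an extended ideal is tested on coefficients, so equality would force every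
      -- coefficient of the relation for `X 0` into `Q`.
      refine height_comap_C_add_one_le fun heq => ?_
      obtain ⟨f, ⟨i, hi⟩, hf⟩ := hQ 0
      refine hi (hC.le ?_)
      have hmem : (f.map MvPolynomial.C : Polynomial (MvPolynomial (Fin m) R)) ∈ Q1 := by
        change e.symm _ ∈ Q
        convert hf
        rw [e.symm_apply_eq]
        clear hf hi
        induction f using Polynomial.induction_on' with
        | add f g hf hg => simp only [map_add, Polynomial.map_add, hf, hg]
        | monomial a x =>
          simp [e, MvPolynomial.finSuccEquiv_apply,
            ← Polynomial.C_mul_X_pow_eq_monomial]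
      rw [heq, Ideal.mem_map_C_iff] at hmem
      have hi' := hmem i
      rw [Polynomial.coeff_map] at hi'
      exact hi'
    have h3 : Q1.height = Q.height := RingEquiv.height_comap e.symm.toRingEquiv Q
    rw [← h3, ← hC]
    push_cast
    rw [← add_assoc]
    exact (add_le_add_left h2 1).trans h1

/-- There are as many equations as variables: Krull's bound height `Q` ≤ `m` meets the lower bound
height `(Q ∩ R) + m`, leaving height zero in a domain. -/
theorem comap_C_eq_bot_of_mem_minimalPrimes [IsNoetherianRing R] [IsDomain R] {m e D : ℕ}
    {G : Fin m → MvPolynomial (Fin m) R} (he : 2 ≤ e) (hG : ∀ j, (G j).IsHomogeneous e) {r : R}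
    (hD : ∀ h : MvPolynomial (Fin m) R, h.IsHomogeneous D →
      MvPolynomial.C r * h ∈ Ideal.span (Set.range G))
    {Q : Ideal (MvPolynomial (Fin m) R)}
    (hQ : Q ∈ (Ideal.span (Set.range fun j => G j - MvPolynomial.X j)).minimalPrimes)
    (hr : MvPolynomial.C r ∉ Q) : Q.comap MvPolynomial.C = ⊥ := by
  have : Q.IsPrime := hQ.1.1
  let L := Q.ResidueField
  have hzero : ∀ p : MvPolynomial (Fin m) R, algebraMap _ L p = 0 ↔ p ∈ Q := fun p =>
    Ideal.algebraMap_residueField_eq_zero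
  have haeval : ∀ p : MvPolynomial (Fin m) R,
      MvPolynomial.aeval (fun j => algebraMap (MvPolynomial (Fin m) R) L (MvPolynomial.X j)) p = algebraMap _ L p :=
    fun p => (MvPolynomial.aeval_algebraMap_apply L MvPolynomial.X p).trans <| by
      rw [MvPolynomial.aeval_X_left_apply]
  have hC : ∀ a : R, algebraMap R L a = algebraMap (MvPolynomial (Fin m) R) L (MvPolynomial.C a) :=
    fun a => by
      rw [IsScalarTower.algebraMap_apply R (MvPolynomial (Fin m) R) L,
        MvPolynomial.algebraMap_eq]
  have halg : ∀ j, ∃ f : Polynomial R, (∃ i, MvPolynomial.C (f.coeff i) ∉ Q) ∧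
      Polynomial.aeval (MvPolynomial.X j) f ∈ Q := by
    intro j
    by_cases hj : (MvPolynomial.X j : MvPolynomial (Fin m) R) ∈ Q
    · refine ⟨Polynomial.X, ⟨1, ?_⟩, by simpa using hj⟩
      simpa using (Ideal.ne_top_iff_one Q).1 this.ne_top
    · have h1 := isAlgebraic_range_of_aeval_eq_self (L := L) he hG (r := r)
        (by rw [hC, Ne, hzero]; exact hr) hD
        (y := fun j => algebraMap (MvPolynomial (Fin m) R) L (MvPolynomial.X j)) (fun i => by
          rw [haeval, ← sub_eq_zero, ← map_sub, hzero]
          exact hQ.1.2 (Ideal.subset_span ⟨i, rfl⟩)) j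
      obtain ⟨f, hf0, hf⟩ := exists_polynomial_of_isAlgebraic_range
        (by rwa [Ne, hzero]) h1
      refine ⟨f, ⟨0, ?_⟩, ?_⟩
      · rwa [hC, Ne, hzero] at hf0
      · rwa [Polynomial.aeval_algebraMap_apply, hzero] at hf
  have h1 := height_comap_C_add_card_le m Q halg
  have h2 : Q.height ≤ m := by
    refine (Ideal.height_le_card_of_mem_minimalPrimes_span (Set.finite_range _) hQ).trans ?_
    have h3 := Set.ncard_image_le (f := fun j => G j - MvPolynomial.X j) (Set.toFinite Set.univ)
    rw [Set.image_univ, Set.ncard_univ, Nat.card_eq_fintype_card, Fintype.card_fin] at h3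
    exact_mod_cast h3
  have h4 : (Q.comap MvPolynomial.C).height + m ≤ 0 + m := by
    rw [zero_add]
    exact h1.trans h2
  rw [← Ideal.height_eq_zero_iff_eq_bot]
  exact le_antisymm ((ENat.add_le_add_iff_right (ENat.natCast_ne_top m)).1 h4) zero_le

end Height

/-! ### Bihomogeneous cones over subsets of a product of projective spaces. -/

section Cones

open MvPolynomial

variable {k : Type*} [Field k] {ι κ : Type*}

/-- Substitution of the scaled coordinates `(T v, U w)`, with values in polynomials in `T, U`. -/
noncomputable def scaleHom (v : ι → k) (w : κ → k) :
    MvPolynomial (ι ⊕ κ) k →ₐ[k] MvPolynomial (Fin 2) k :=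
  aeval (Sum.elim (fun i => C (v i) * X 0) (fun j => C (w j) * X 1))

theorem eval_scaleHom (v : ι → k) (w : κ → k) (p : MvPolynomial (ι ⊕ κ) k) (z : Fin 2 → k) :
    eval z (scaleHom v w p) = eval (Sum.elim (z 0 • v) (z 1 • w)) p := by
  induction p using MvPolynomial.induction_on with
  | C a => simp [scaleHom]
  | add p q hp hq => simp only [map_add, hp, hq]
  | mul_X p i hp =>
    rw [map_mul, map_mul, hp, map_mul]
    rcases i with i | i <;> simp [scaleHom, mul_comm]

theorem scaleHom_of_isBihomogeneous [Infinite k] (v : ι → k) (w : κ → k)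
    {p : MvPolynomial (ι ⊕ κ) k} {e : ℕ × ℕ} (hp : IsBihomogeneous p e) :
    scaleHom v w p =
      monomial (Finsupp.single 0 e.1 + Finsupp.single 1 e.2) (eval (Sum.elim v w) p) := by
  refine MvPolynomial.funext fun z => ?_
  rw [eval_scaleHom, eval_smul_of_isBihomogeneous hp, eval_monomial,
    Finsupp.prod_add_index' (by simp) (by intros; rw [pow_add])]
  simp [mul_comm]

theorem scaleHom_eq_zero [Infinite k] {v : ι → k} {w : κ → k} {p : MvPolynomial (ι ⊕ κ) k}
    (h : ∀ t u : k, t ≠ 0 → u ≠ 0 → eval (Sum.elim (t • v) (u • w)) p = 0) :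
    scaleHom v w p = 0 := by
  refine MvPolynomial.funext_set (fun _ => {0}ᶜ)
    (fun _ => (Set.finite_singleton 0).infinite_compl) fun z hz => ?_
  rw [eval_scaleHom, map_zero]
  exact h _ _ (hz 0 trivial) (hz 1 trivial)

-- The coefficient of `T^a U^b` in `scaleHom v w p` is the value at `(v, w)` of the component of `p`
-- of bidegree `(a, b)`. This lets arbitrary polynomials define closed subsets of the product.
open Classical in
theorem scaleHom_eq_zero_iff [Infinite k] {v : ι → k} {w : κ → k} {p : MvPolynomial (ι ⊕ κ) k} :
    scaleHom v w p = 0 ↔ ∀ e : ℕ × ℕ, eval (Sum.elim v w) (weightedHomogeneousComponent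
      (Sum.elim (fun _ => ((1, 0) : ℕ × ℕ)) (fun _ => ((0, 1) : ℕ × ℕ))) e p) = 0 := by
  set W : ι ⊕ κ → ℕ × ℕ := Sum.elim (fun _ => ((1, 0) : ℕ × ℕ)) (fun _ => ((0, 1) : ℕ × ℕ))
  have hsum : scaleHom v w p = ∑ e ∈ (weightedHomogeneousComponent_finsupp (w := W) p).toFinset,
      monomial (Finsupp.single 0 e.1 + Finsupp.single 1 e.2)
        (eval (Sum.elim v w) (weightedHomogeneousComponent W e p)) := by
    conv_lhs => rw [← sum_weightedHomogeneousComponent W p,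
      finsum_eq_sum _ (weightedHomogeneousComponent_finsupp (w := W) p), map_sum]
    exact Finset.sum_congr rfl fun e _ => scaleHom_of_isBihomogeneous v w
      (weightedHomogeneousComponent_isWeightedHomogeneous e p)
  constructor
  · intro h0 e
    by_cases he : e ∈ (weightedHomogeneousComponent_finsupp (w := W) p).toFinset
    · have h1 := congrArg (coeff (Finsupp.single 0 e.1 + Finsupp.single 1 e.2)) h0
      rw [hsum, coeff_sum, coeff_zero, Finset.sum_eq_single e] at h1
      · rwa [coeff_monomial, if_pos rfl] at h1
      · intro e' _ hne
        rw [coeff_monomial, if_neg]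
        intro heq
        refine hne (Prod.ext ?_ ?_)
        · simpa using DFunLike.congr_fun heq 0
        · simpa using DFunLike.congr_fun heq 1
      · exact fun h => absurd he h
    · have : weightedHomogeneousComponent W e p = 0 := by
        by_contra hne
        exact he ((Set.Finite.mem_toFinset _).2 hne)
      rw [this, map_zero]
  · intro h
    rw [hsum]
    exact Finset.sum_eq_zero fun e _ => by rw [h e, monomial_zero]

/-- The point of the product with given homogeneous coordinates. -/
def BiProj.of (v : ι → k) (hv : v ≠ 0) (w : κ → k) (hw : w ≠ 0) : BiProj k ι κ :=
  ⟨Projectivization.mk k v hv, Projectivization.mk k w hw⟩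

theorem BiProj.of_rep (x : BiProj k ι κ) :
    BiProj.of x.fst.rep x.fst.rep_nonzero x.snd.rep x.snd.rep_nonzero = x := by
  simp [BiProj.of, Projectivization.mk_rep]

theorem BiProj.of_smul (v : ι → k) (hv : v ≠ 0) (w : κ → k) (hw : w ≠ 0) {t u : k} (ht : t ≠ 0)
    (hu : u ≠ 0) :
    BiProj.of (t • v) (smul_ne_zero ht hv) (u • w) (smul_ne_zero hu hw) = BiProj.of v hv w hw := by
  simp only [BiProj.of, BiProj.mk.injEq, Projectivization.mk_eq_mk_iff']
  exact ⟨⟨t, rfl⟩, ⟨u, rfl⟩⟩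

theorem BiProj.exists_of_eq {v v' : ι → k} {hv : v ≠ 0} {hv' : v' ≠ 0} {w w' : κ → k} {hw : w ≠ 0}
    {hw' : w' ≠ 0} (h : BiProj.of v hv w hw = BiProj.of v' hv' w' hw') :
    ∃ t u : k, t ≠ 0 ∧ u ≠ 0 ∧ v = t • v' ∧ w = u • w' := by
  simp only [BiProj.of, BiProj.mk.injEq, Projectivization.mk_eq_mk_iff'] at h
  obtain ⟨⟨t, rfl⟩, ⟨u, rfl⟩⟩ := h
  exact ⟨t, u, fun h => hv (by simp [h]), fun h => hw (by simp [h]), rfl, rfl⟩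

theorem isClosed_setOf_scaleHom_eq_zero [Infinite k] (p : MvPolynomial (ι ⊕ κ) k) :
    IsClosed {x : BiProj k ι κ | scaleHom x.fst.rep x.snd.rep p = 0} := by
  rw [isClosed_biProj_iff]
  refine ⟨Set.range fun e : ℕ × ℕ => weightedHomogeneousComponent
    (Sum.elim (fun _ => ((1, 0) : ℕ × ℕ)) (fun _ => ((0, 1) : ℕ × ℕ))) e p, ?_, ?_⟩
  · rintro _ ⟨e, rfl⟩
    exact ⟨e, weightedHomogeneousComponent_isWeightedHomogeneous e p⟩
  · ext x
    simp only [Set.mem_ofPred_eq, scaleHom_eq_zero_iff, biprojZeros, Set.forall_mem_range,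
      BiProj.evalRep]

variable (k ι κ) in
/-- Polynomials in two sets of variables as polynomials in the second set over polynomials in the
first set. -/
noncomputable def iterEquiv :
    MvPolynomial (ι ⊕ κ) k ≃ₐ[k] MvPolynomial κ (MvPolynomial ι k) :=
  (renameEquiv k (Equiv.sumComm ι κ)).trans (sumAlgEquiv k κ ι)

/-- Evaluation of an iterated polynomial. -/
noncomputable def evalIter (v : ι → k) (w : κ → k) : MvPolynomial κ (MvPolynomial ι k) →+* k :=
  (eval w).comp (map (eval v))

@[simp]
theorem evalIter_C (v : ι → k) (w : κ → k) (a : MvPolynomial ι k) :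
    evalIter v w (C a) = eval v a := by
  simp [evalIter]

@[simp]
theorem evalIter_X (v : ι → k) (w : κ → k) (j : κ) :
    evalIter v w (X j) = w j := by
  simp [evalIter]

theorem evalIter_iterEquiv (v : ι → k) (w : κ → k) (p : MvPolynomial (ι ⊕ κ) k) :
    evalIter v w (iterEquiv k ι κ p) = eval (Sum.elim v w) p := by
  induction p using MvPolynomial.induction_on with
  | C a => simp [iterEquiv]
  | add p q hp hq => simp only [map_add, hp, hq]
  | mul_X p i hp =>
    rw [map_mul, map_mul, hp, map_mul]
    rcases i with i | i <;> simp [iterEquiv]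

theorem eval_iterEquiv_symm (v : ι → k) (w : κ → k) (p : MvPolynomial κ (MvPolynomial ι k)) :
    eval (Sum.elim v w) ((iterEquiv k ι κ).symm p) = evalIter v w p := by
  rw [← evalIter_iterEquiv, AlgEquiv.apply_symm_apply]

/-- The Nullstellensatz for the radical ideal `Q`, carried over to iterated polynomials. -/
theorem mem_of_forall_evalIter_eq_zero [IsAlgClosed k] [Finite ι] [Finite κ]
    (Q : Ideal (MvPolynomial κ (MvPolynomial ι k))) [Q.IsPrime]
    {h : MvPolynomial κ (MvPolynomial ι k)}
    (hh : ∀ v w, (∀ q ∈ Q, evalIter v w q = 0) → evalIter v w h = 0) : h ∈ Q := by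
  have hP : (Q.comap (iterEquiv k ι κ)).IsPrime := Ideal.comap_isPrime _ _
  have h1 : (iterEquiv k ι κ).symm h ∈ Q.comap (iterEquiv k ι κ) := by
    rw [← hP.isRadical.radical, ← vanishingIdeal_zeroLocus_eq_radical (K := k)]
    intro z hz
    have hz' : z = Sum.elim (z ∘ Sum.inl) (z ∘ Sum.inr) := (Sum.elim_comp_inl_inr z).symm
    have haev : ∀ p, aeval z p = eval z p := fun p => by rw [← coe_aeval_eq_eval]; rfl
    rw [haev, hz', eval_iterEquiv_symm]
    refine hh _ _ fun q hq => ?_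
    have := hz ((iterEquiv k ι κ).symm q) (by simpa [Ideal.mem_comap] using hq)
    rwa [haev, hz', eval_iterEquiv_symm] at this
  simpa [Ideal.mem_comap] using h1

theorem isHomogeneous_iterEquiv {p : MvPolynomial (ι ⊕ κ) k} {e : ℕ × ℕ}
    (hp : IsBihomogeneous p e) : (iterEquiv k ι κ p).IsHomogeneous e.2 := by
  rw [as_sum p, map_sum]
  refine IsHomogeneous.sum _ _ _ fun m hm => ?_
  have hwt := hp (mem_support_iff.1 hm)
  rw [Finsupp.weight_apply, Finsupp.sum] at hwt
  have hdeg : 0 + ∑ i ∈ m.support, (Sum.elim (fun _ => 0) (fun _ => 1) i) * m i = e.2 := by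
    rw [← hwt, Prod.snd_sum, zero_add]
    refine Finset.sum_congr rfl fun i _ => ?_
    rcases i with i | i <;> simp
  rw [monomial_eq, map_mul, Finsupp.prod, map_prod, ← hdeg]
  refine IsHomogeneous.mul ?_ (IsHomogeneous.prod _ _ _ fun i _ => ?_)
  · have : iterEquiv k ι κ (C (coeff m p)) = C (C (coeff m p)) := by simp [iterEquiv]
    rw [this]
    exact isHomogeneous_C κ _
  · rw [map_pow]
    refine IsHomogeneous.pow ?_ _
    rcases i with i | i
    · have : iterEquiv k ι κ (X (Sum.inl i)) = C (X i) := by simp [iterEquiv]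
      rw [this]
      exact isHomogeneous_C κ _
    · have : iterEquiv k ι κ (X (Sum.inr i)) = X i := by simp [iterEquiv]
      rw [this]
      exact isHomogeneous_X _ _

/-- Closed subsets of the product are cut out by polynomials that are homogeneous in the second set
of variables. -/
theorem exists_evalIter_of_isClosed {C : Set (BiProj k ι κ)} (hC : IsClosed C) :
    ∃ T : Set (MvPolynomial κ (MvPolynomial ι k)), (∀ p ∈ T, ∃ b, p.IsHomogeneous b) ∧
      ∀ v hv w hw, BiProj.of v hv w hw ∈ C ↔ ∀ p ∈ T, evalIter v w p = 0 := by
  obtain ⟨S, hS, rfl⟩ := (isClosed_biProj_iff C).1 hC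
  refine ⟨iterEquiv k ι κ '' S, ?_, fun v hv w hw => ?_⟩
  · rintro _ ⟨p, hp, rfl⟩
    obtain ⟨e, he⟩ := hS p hp
    exact ⟨e.2, isHomogeneous_iterEquiv he⟩
  · simp only [Set.forall_mem_image, evalIter_iterEquiv, biprojZeros, Set.mem_ofPred_eq]
    refine forall₂_congr fun p hp => ?_
    obtain ⟨e, he⟩ := hS p hp
    exact evalRep_mk_eq_zero_iff he v hv w hw

/-- The polynomials that vanish on the cone over a subset of the product. -/
noncomputable def coneIdeal (Z : Set (BiProj k ι κ)) : Ideal (MvPolynomial κ (MvPolynomial ι k)) where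
  carrier := {p | ∀ v hv w hw, BiProj.of v hv w hw ∈ Z → evalIter v w p = 0}
  zero_mem' _ _ _ _ _ := map_zero _
  add_mem' {p q} hp hq v hv w hw h := by rw [map_add, hp v hv w hw h, hq v hv w hw h, add_zero]
  smul_mem' p q hq v hv w hw h := by rw [smul_eq_mul, map_mul, hq v hv w hw h, mul_zero]

theorem mem_coneIdeal_iff_scaleHom [Infinite k] {Z : Set (BiProj k ι κ)}
    {p : MvPolynomial κ (MvPolynomial ι k)} :
    p ∈ coneIdeal Z ↔ ∀ x ∈ Z, scaleHom x.fst.rep x.snd.rep ((iterEquiv k ι κ).symm p) = 0 := by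
  constructor
  · intro h x hx
    refine scaleHom_eq_zero fun t u ht hu => ?_
    rw [eval_iterEquiv_symm]
    refine h _ (smul_ne_zero ht x.fst.rep_nonzero) _ (smul_ne_zero hu x.snd.rep_nonzero) ?_
    rwa [BiProj.of_smul x.fst.rep x.fst.rep_nonzero x.snd.rep x.snd.rep_nonzero ht hu,
      BiProj.of_rep]
  · intro h v hv w hw hZ
    obtain ⟨t, u, -, -, htv, huw⟩ := BiProj.exists_of_eq (BiProj.of_rep (BiProj.of v hv w hw)).symm
    have h1 := eval_scaleHom (BiProj.of v hv w hw).fst.rep (BiProj.of v hv w hw).snd.rep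
      ((iterEquiv k ι κ).symm p) ![t, u]
    rw [h _ hZ, map_zero] at h1
    rw [← eval_iterEquiv_symm]
    exact (congrArg₂ (fun a b => eval (Sum.elim a b) ((iterEquiv k ι κ).symm p)) htv huw).trans
      h1.symm

/-- Since `scaleHom` takes values in a domain, a product in the ideal covers `Z` by two closed sets,
one for each factor. -/
theorem coneIdeal_isPrime [Infinite k] {Z : Set (BiProj k ι κ)} (hZ : IsIrreducible Z) :
    (coneIdeal Z).IsPrime := by
  refine ⟨?_, fun {p q} hpq => ?_⟩
  · obtain ⟨x, hx⟩ := hZ.nonempty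
    rw [Ne, Ideal.eq_top_iff_one]
    intro h
    have := h _ x.fst.rep_nonzero _ x.snd.rep_nonzero (by rwa [BiProj.of_rep])
    rw [map_one] at this
    exact one_ne_zero this
  · simp only [mem_coneIdeal_iff_scaleHom] at hpq ⊢
    refine isPreirreducible_iff_isClosed_union_isClosed.1 hZ.isPreirreducible _ _
      (isClosed_setOf_scaleHom_eq_zero ((iterEquiv k ι κ).symm p))
      (isClosed_setOf_scaleHom_eq_zero ((iterEquiv k ι κ).symm q)) fun x hx => ?_
    have := hpq x hx
    rw [map_mul, map_mul] at this
    exact mul_eq_zero.1 this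

end Cones

/-! ### The projection along a projective space, and Noetherianity. -/

section Projection

open MvPolynomial

variable {k : Type*} [Field k] {ι κ : Type*}

/-- Elimination produces polynomials that need not be homogeneous. Vanishing on a whole punctured
line means that all homogeneous components vanish, as a polynomial in `t` with infinitely many roots
is zero. -/
theorem isClosed_setOf_forall_eval_smul_eq_zero [Infinite k] (r : MvPolynomial ι k) :
    IsClosed {P : ℙ k (ι → k) | ∀ t : k, t ≠ 0 → eval (t • P.rep) r = 0} := by
  rw [isClosed_proj_iff]
  refine ⟨Set.range fun a : ℕ => homogeneousComponent a r, ?_, ?_⟩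
  · rintro _ ⟨a, rfl⟩
    exact ⟨a, homogeneousComponent_isHomogeneous a r⟩
  · ext P
    simp only [Set.mem_ofPred_eq, projZeros, Set.forall_mem_range]
    have hsum : ∀ t : k, eval (t • P.rep) r =
        (∑ a ∈ Finset.range (r.totalDegree + 1),
          Polynomial.monomial a (eval P.rep (homogeneousComponent a r))).eval t := by
      intro t
      conv_lhs => rw [← sum_homogeneousComponent r, map_sum]
      rw [Polynomial.eval_finsetSum]
      refine Finset.sum_congr rfl fun a _ => ?_
      rw [eval_smul_of_isHomogeneous (homogeneousComponent_isHomogeneous a r),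
        Polynomial.eval_monomial, mul_comm]
    constructor
    · intro h a
      by_cases ha : a ∈ Finset.range (r.totalDegree + 1)
      · have h0 := Polynomial.eq_zero_of_infinite_isRoot _
          ((Set.finite_singleton (0 : k)).infinite_compl.mono fun t ht =>
            (hsum t).symm.trans (h t ht))
        have h1 := congrArg (fun q => Polynomial.coeff q a) h0
        simp only [Polynomial.finsetSum_coeff, Polynomial.coeff_zero] at h1
        rw [Finset.sum_eq_single a] at h1
        · rwa [Polynomial.coeff_monomial, if_pos rfl] at h1
        · intro b _ hb
          rw [Polynomial.coeff_monomial, if_neg hb]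
        · exact fun h => absurd ha h
      · rw [homogeneousComponent_eq_zero, map_zero]
        simpa using ha
    · intro h t _
      rw [hsum]
      simp [h]

theorem continuous_biProj_fst [Infinite k] :
    Continuous (BiProj.fst : BiProj k ι κ → ℙ k (ι → k)) := by
  rw [continuous_iff_isClosed]
  intro K hK
  obtain ⟨S, hS, rfl⟩ := (isClosed_proj_iff K).1 hK
  have : BiProj.fst ⁻¹' projZeros S = ⋂ p ∈ S,
      {x : BiProj k ι κ | scaleHom x.fst.rep x.snd.rep ((iterEquiv k ι κ).symm (C p)) = 0} := by
    ext x
    simp only [Set.mem_preimage, projZeros, Set.mem_ofPred_eq, Set.mem_iInter]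
    refine forall₂_congr fun p hp => ?_
    obtain ⟨a, ha⟩ := hS p hp
    constructor
    · intro h
      refine scaleHom_eq_zero fun t u _ _ => ?_
      rw [eval_iterEquiv_symm, evalIter_C, eval_smul_of_isHomogeneous ha, h, mul_zero]
    · intro h
      have h1 := eval_scaleHom x.fst.rep x.snd.rep ((iterEquiv k ι κ).symm (C p)) ![1, 1]
      rw [h, map_zero] at h1
      simpa [eval_iterEquiv_symm] using h1.symm
  rw [this]
  exact isClosed_biInter fun p _ => isClosed_setOf_scaleHom_eq_zero _

/-- The projection along a projective space is a closed map. -/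
theorem isClosedMap_biProj_fst [IsAlgClosed k] [Finite κ] :
    IsClosedMap (BiProj.fst : BiProj k ι κ → ℙ k (ι → k)) := by
  intro C hC
  obtain ⟨T, hT, hCT⟩ := exists_evalIter_of_isClosed hC
  have := IsAlgClosed.instInfinite (K := k)
  -- For `P` off the image the equations of `C` have no nontrivial zero over `P`. Elimination gives
  -- `r` nonzero at `P`, while over a point of the image `r` times a nonzero power of a coordinate
  -- is zero.
  have key : ∀ P : ℙ k (ι → k), P ∉ BiProj.fst '' C →
      ∃ r : MvPolynomial ι k, P ∉ {P : ℙ k (ι → k) | ∀ t : k, t ≠ 0 → eval (t • P.rep) r = 0} ∧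
        BiProj.fst '' C ⊆ {P : ℙ k (ι → k) | ∀ t : k, t ≠ 0 → eval (t • P.rep) r = 0} := by
    intro P hP
    obtain ⟨D, r, hr, hD⟩ := exists_C_mul_mem_span_of_no_zero (eval P.rep)
      (fun a => ⟨MvPolynomial.C a, eval_C a⟩) T hT (by
        intro w hw
        by_contra! h
        exact hP ⟨_, (hCT P.rep P.rep_nonzero w hw).2 h, Projectivization.mk_rep P⟩)
    refine ⟨r, fun h => hr (by simpa using h 1 one_ne_zero), ?_⟩
    rintro _ ⟨x, hx, rfl⟩ t ht
    have hx' : BiProj.of (t • x.fst.rep) (smul_ne_zero ht x.fst.rep_nonzero)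
        ((1 : k) • x.snd.rep) (smul_ne_zero one_ne_zero x.snd.rep_nonzero) ∈ C := by
      rwa [BiProj.of_smul x.fst.rep x.fst.rep_nonzero x.snd.rep x.snd.rep_nonzero ht one_ne_zero,
        BiProj.of_rep]
    have hzero := (hCT _ _ _ _).1 hx'
    obtain ⟨i, hi⟩ := Function.ne_iff.1 x.snd.rep_nonzero
    have hle : Ideal.span T ≤ RingHom.ker (evalIter (t • x.fst.rep) ((1 : k) • x.snd.rep)) :=
      Ideal.span_le.2 hzero
    have h1 := hle (hD _ (isHomogeneous_X_pow i D))
    rw [RingHom.mem_ker, map_mul, map_pow, evalIter_C, evalIter_X, one_smul] at h1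
    exact (mul_eq_zero.1 h1).resolve_right (pow_ne_zero _ hi)
  choose! r hr hrC using key
  have : BiProj.fst '' C = ⋂ P ∈ (BiProj.fst '' C)ᶜ,
      {P' : ℙ k (ι → k) | ∀ t : k, t ≠ 0 → eval (t • P'.rep) (r P) = 0} := by
    refine Set.Subset.antisymm (Set.subset_iInter₂ fun P hP => hrC P hP) fun P hP => ?_
    by_contra hPC
    exact hr P hPC (Set.mem_iInter₂.1 hP P hPC)
  rw [this]
  exact isClosed_biInter fun P _ => isClosed_setOf_forall_eval_smul_eq_zero _

/-- Closed sets embed, with order reversed, into the ideals of a Noetherian ring. -/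
theorem noetherianSpace_biProj [Infinite k] [Finite ι] [Finite κ] :
    TopologicalSpace.NoetherianSpace (BiProj k ι κ) := by
  have hanti : StrictAnti fun Z : TopologicalSpace.Closeds (BiProj k ι κ) =>
      coneIdeal (Z : Set (BiProj k ι κ)) := by
    intro Z Z' hlt
    refine lt_of_le_not_ge (fun p hp v hv w hw h => hp v hv w hw (hlt.le h)) fun hle => ?_
    refine hlt.not_ge fun x hx => ?_
    obtain ⟨T, -, hT⟩ := exists_evalIter_of_isClosed Z.isClosed
    rw [← BiProj.of_rep x] at hx ⊢
    refine (hT _ _ _ _).2 fun p hp => ?_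
    exact hle (fun v hv w hw h => (hT v hv w hw).1 h p hp : p ∈ coneIdeal _) _ _ _ _ hx
  exact ((TopologicalSpace.noetherianSpace_TFAE (BiProj k ι κ)).out 0 1).2 hanti.wellFoundedLT

end Projection

/-! ### Iterates of the generic endomorphism and equations of the incidence variety. -/

section Forms

open MvPolynomial

variable {k : Type*} [Field k] {n d : ℕ}

variable (k n d) in
/-- The forms in `x_0, …, x_n` with generic coefficients that give the iterates of the generic
endomorphism. -/
noncomputable def iterForm : ℕ → Fin (n + 1) →
    MvPolynomial (Fin (n + 1)) (MvPolynomial (CoeffIdx n d) k)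
  | 0, j => X j
  | s + 1, i => ∑ α : Exponents n d, C (X (i, α)) * ∏ j, iterForm s j ^ α.1 j

theorem iterForm_isHomogeneous (s : ℕ) (j : Fin (n + 1)) :
    (iterForm k n d s j).IsHomogeneous (d ^ s) := by
  induction s generalizing j with
  | zero => simpa [iterForm] using isHomogeneous_X _ j
  | succ s ih =>
    rw [iterForm]
    refine IsHomogeneous.sum _ _ _ fun α _ => IsHomogeneous.C_mul ?_ _
    have h : ∑ j, α.1 j = d := (Finset.mem_finsuppAntidiag.mp α.2).1
    have h2 : d ^ (s + 1) = ∑ j, d ^ s * α.1 j := by rw [← Finset.mul_sum, h, pow_succ]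
    rw [h2]
    exact IsHomogeneous.prod _ _ _ fun j _ => (ih j).pow _

theorem evalIter_iterForm (c : CoeffIdx n d → k) (w : Fin (n + 1) → k) (s : ℕ) (j : Fin (n + 1)) :
    evalIter c w (iterForm k n d s j) = (evalForms c)^[s] w j := by
  induction s generalizing j with
  | zero => simp [iterForm]
  | succ s ih =>
    rw [iterForm, Function.iterate_succ_apply', map_sum, evalForms, form, map_sum]
    refine Finset.sum_congr rfl fun α _ => ?_
    rw [eval_monomial, Finsupp.prod_fintype _ _ (by simp)]
    simp [ih]

theorem iterate_evalForms_smul (c : CoeffIdx n d → k) (u : k) (w : Fin (n + 1) → k) (s : ℕ) :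
    (evalForms c)^[s] (u • w) = u ^ d ^ s • (evalForms c)^[s] w := by
  funext j
  rw [Pi.smul_apply, ← evalIter_iterForm, ← evalIter_iterForm]
  exact eval_smul_of_isHomogeneous ((iterForm_isHomogeneous s j).map _) u w

theorem iterate_evalForms_ne_zero {c : CoeffIdx n d → k} (hc : ∀ v, v ≠ 0 → evalForms c v ≠ 0)
    {w : Fin (n + 1) → k} (hw : w ≠ 0) (s : ℕ) : (evalForms c)^[s] w ≠ 0 := by
  induction s with
  | zero => exact hw
  | succ s ih =>
    rw [Function.iterate_succ_apply']
    exact hc _ ih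

theorem iterate_endMap_mk {c : CoeffIdx n d → k} {hc : c ≠ 0}
    (hf : Projectivization.mk k c hc ∈ EndSpace k n d) {w : Fin (n + 1) → k} (hw : w ≠ 0) (s : ℕ) :
    (endMap ⟨_, hf⟩)^[s] (Projectivization.mk k w hw) =
      Projectivization.mk k ((evalForms c)^[s] w)
        (iterate_evalForms_ne_zero ((mk_mem_endSpace_iff c hc).1 hf) hw s) := by
  induction s with
  | zero => rfl
  | succ s ih =>
    simp only [Function.iterate_succ_apply', ih]
    exact endMap_mk c hc hf _ _

theorem of_mem_incidence_iff {c : CoeffIdx n d → k} {hc : c ≠ 0} {w : Fin (n + 1) → k} {hw : w ≠ 0}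
    {s : ℕ} : BiProj.of c hc w hw ∈ Incidence k n d s ↔
      (∀ v, v ≠ 0 → evalForms c v ≠ 0) ∧ ∃ t : k, (evalForms c)^[s] w = t • w := by
  constructor
  · rintro ⟨hf, h⟩
    refine ⟨(mk_mem_endSpace_iff c hc).1 hf, ?_⟩
    have h' := (iterate_endMap_mk hf hw s).symm.trans h
    rw [BiProj.of, Projectivization.mk_eq_mk_iff'] at h'
    obtain ⟨t, ht⟩ := h'
    exact ⟨t, ht.symm⟩
  · rintro ⟨hf, t, ht⟩
    refine ⟨(mk_mem_endSpace_iff c hc).2 hf, ?_⟩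
    refine (iterate_endMap_mk _ hw s).trans ?_
    rw [BiProj.of, Projectivization.mk_eq_mk_iff']
    exact ⟨t, ht.symm⟩

theorem exists_eq_smul_of_minors {w F : Fin (n + 1) → k} (hw : w ≠ 0)
    (h : ∀ i j, w i * F j = w j * F i) : ∃ t : k, F = t • w := by
  obtain ⟨i, hi⟩ := Function.ne_iff.1 hw
  refine ⟨F i / w i, funext fun j => ?_⟩
  have hi' : w i ≠ 0 := hi
  rw [Pi.smul_apply, smul_eq_mul]
  field_simp
  rw [mul_comm, h, mul_comm]

theorem exists_isClosed_incidence [Infinite k] (s : ℕ) :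
    ∃ K : Set (BiProj k (CoeffIdx n d) (Fin (n + 1))), IsClosed K ∧
      Incidence k n d s = K ∩ EndTimesProj k n d := by
  -- These are the 2×2 minors expressing that `F^s(w)` is proportional to `w`.
  let p (i j : Fin (n + 1)) := X i * iterForm k n d s j - X j * iterForm k n d s i
  have hp : ∀ i j, p i j ∈ coneIdeal (Incidence k n d s) := by
    intro i j c hc w hw h
    obtain ⟨-, t, ht⟩ := of_mem_incidence_iff.1 h
    simp only [p, map_sub, map_mul, evalIter_X, evalIter_iterForm, ht, Pi.smul_apply, smul_eq_mul]
    ring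
  refine ⟨⋂ i, ⋂ j, {x | scaleHom x.fst.rep x.snd.rep ((iterEquiv k _ _).symm (p i j)) = 0},
    isClosed_iInter fun i => isClosed_iInter fun j => isClosed_setOf_scaleHom_eq_zero _,
    Set.Subset.antisymm (fun x hx => ⟨?_, hx.1⟩) fun x hx => ?_⟩
  · exact Set.mem_iInter₂.2 fun i j => mem_coneIdeal_iff_scaleHom.1 (hp i j) x hx
  · have hx2 : BiProj.of x.fst.rep x.fst.rep_nonzero x.snd.rep x.snd.rep_nonzero ∈
        EndTimesProj k n d := by rw [BiProj.of_rep]; exact hx.2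
    rw [← BiProj.of_rep x, of_mem_incidence_iff]
    refine ⟨(mk_mem_endSpace_iff _ _).1 hx2,
      exists_eq_smul_of_minors x.snd.rep_nonzero fun i j => ?_⟩
    have h1 := eval_scaleHom x.fst.rep x.snd.rep ((iterEquiv k _ _).symm (p i j)) ![1, 1]
    have h2 : scaleHom x.fst.rep x.snd.rep ((iterEquiv k _ _).symm (p i j)) = 0 :=
      Set.mem_iInter₂.1 hx.1 i j
    rw [h2, map_zero] at h1
    simp only [Matrix.cons_val_zero, Matrix.cons_val_one, one_smul, eval_iterEquiv_symm] at h1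
    simpa [p, evalIter_iterForm, sub_eq_zero] using h1.symm

end Forms

/-! ### Each component of the incidence variety surjects onto the space of endomorphisms. -/

section IncidenceComponents

open MvPolynomial

variable {k : Type*} [Field k] {n d : ℕ}

theorem ne_zero_of_evalForms_ne_zero {c : CoeffIdx n d → k}
    (hc : ∀ v, v ≠ 0 → evalForms c v ≠ 0) : c ≠ 0 := by
  rintro rfl
  refine hc 1 one_ne_zero (funext fun i => ?_)
  simp [evalForms, form]

theorem exists_C_mul_mem_span_iterForm [IsAlgClosed k] {c : CoeffIdx n d → k}
    (hc : ∀ v, v ≠ 0 → evalForms c v ≠ 0) (s : ℕ) :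
    ∃ (D : ℕ) (r : MvPolynomial (CoeffIdx n d) k), eval c r ≠ 0 ∧
      ∀ h : MvPolynomial (Fin (n + 1)) (MvPolynomial (CoeffIdx n d) k), h.IsHomogeneous D →
        C r * h ∈ Ideal.span (Set.range (iterForm k n d s)) := by
  refine exists_C_mul_mem_span_of_no_zero (eval c) (fun a => ⟨C a, eval_C a⟩) _ ?_ ?_
  · rintro _ ⟨j, rfl⟩
    exact ⟨_, iterForm_isHomogeneous s j⟩
  · intro w hw
    obtain ⟨j, hj⟩ := Function.ne_iff.1 (iterate_evalForms_ne_zero hc hw s)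
    exact ⟨_, ⟨j, rfl⟩, by rwa [← evalIter_iterForm] at hj⟩

/-- A common zero of the forms is also one of their `s`-th iterate, and this would make `r` times a
nonzero power of a coordinate vanish. So `r ≠ 0` defines an open set of endomorphisms. -/
theorem evalForms_ne_zero_of_C_mul_mem_span {s D : ℕ} (hd : d ≠ 0) (hs : s ≠ 0)
    {r : MvPolynomial (CoeffIdx n d) k}
    (hD : ∀ h : MvPolynomial (Fin (n + 1)) (MvPolynomial (CoeffIdx n d) k), h.IsHomogeneous D →
        C r * h ∈ Ideal.span (Set.range (iterForm k n d s)))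
    {c : CoeffIdx n d → k} (hr : eval c r ≠ 0) (v : Fin (n + 1) → k) (hv : v ≠ 0) :
    evalForms c v ≠ 0 := by
  intro h0
  have hF : (evalForms c)^[s] v = 0 := by
    obtain ⟨s, rfl⟩ := Nat.exists_eq_succ_of_ne_zero hs
    rw [Function.iterate_succ_apply, h0]
    have := iterate_evalForms_smul c 0 0 s
    rwa [smul_zero, zero_pow (pow_ne_zero _ hd), zero_smul] at this
  obtain ⟨i, hi⟩ := Function.ne_iff.1 hv
  have hle : Ideal.span (Set.range (iterForm k n d s)) ≤ RingHom.ker (evalIter c v) := by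
    rw [Ideal.span_le]
    rintro _ ⟨j, rfl⟩
    rw [SetLike.mem_coe, RingHom.mem_ker, evalIter_iterForm, hF, Pi.zero_apply]
  have h1 := hle (hD _ (isHomogeneous_X_pow i D))
  rw [RingHom.mem_ker, map_mul, map_pow, evalIter_C, evalIter_X] at h1
  exact mul_ne_zero hr (pow_ne_zero _ hi) h1

/-- The pairs `(f, P)`, with `f` an endomorphism, having homogeneous coordinates in the zero locus
of an ideal. -/
def endLocus (Q : Ideal (MvPolynomial (Fin (n + 1)) (MvPolynomial (CoeffIdx n d) k))) :
    Set (BiProj k (CoeffIdx n d) (Fin (n + 1))) :=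
  {x | ∃ c hc w hw, x = BiProj.of c hc w hw ∧ (∀ v, v ≠ 0 → evalForms c v ≠ 0) ∧
    ∀ q ∈ Q, evalIter c w q = 0}

variable (k n d) in
/-- The ideal of the pairs `(c, w)` for which `w` is fixed by the `s`-th iterate of the tuple of
forms with coefficients `c`. -/
noncomputable def fixIdeal (s : ℕ) :
    Ideal (MvPolynomial (Fin (n + 1)) (MvPolynomial (CoeffIdx n d) k)) :=
  Ideal.span (Set.range fun j => iterForm k n d s j - X j)

theorem iterate_evalForms_eq_self {s : ℕ}
    {Q : Ideal (MvPolynomial (Fin (n + 1)) (MvPolynomial (CoeffIdx n d) k))}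
    (hQ : fixIdeal k n d s ≤ Q) {c : CoeffIdx n d → k} {w : Fin (n + 1) → k}
    (h : ∀ q ∈ Q, evalIter c w q = 0) : (evalForms c)^[s] w = w := by
  funext j
  have := h _ (hQ (Ideal.subset_span ⟨j, rfl⟩))
  rwa [map_sub, evalIter_X, evalIter_iterForm, sub_eq_zero] at this

theorem endLocus_subset_incidence {s : ℕ}
    {Q : Ideal (MvPolynomial (Fin (n + 1)) (MvPolynomial (CoeffIdx n d) k))}
    (hQ : fixIdeal k n d s ≤ Q) : endLocus Q ⊆ Incidence k n d s := by
  rintro _ ⟨c, hc, w, hw, rfl, hf, h⟩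
  exact of_mem_incidence_iff.2 ⟨hf, 1, by rw [one_smul, iterate_evalForms_eq_self hQ h]⟩

theorem exists_mem_endLocus_of_mem_incidence [IsAlgClosed k] (hd : 2 ≤ d) {s : ℕ} (hs : s ≠ 0)
    {x : BiProj k (CoeffIdx n d) (Fin (n + 1))} (hx : x ∈ Incidence k n d s) :
    ∃ Q ∈ (fixIdeal k n d s).minimalPrimes, x ∈ endLocus Q := by
  rw [← BiProj.of_rep x, of_mem_incidence_iff] at hx
  obtain ⟨hf, t, ht⟩ := hx
  have ht0 : t ≠ 0 := by
    rintro rfl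
    exact iterate_evalForms_ne_zero hf x.snd.rep_nonzero s (by rw [ht, zero_smul])
  have he : 2 ≤ d ^ s := hd.trans (Nat.le_self_pow hs d)
  -- With this `u`, `F^s(u w) = u^(d^s) t w = u w`.
  obtain ⟨u, hu⟩ := IsAlgClosed.exists_pow_nat_eq t⁻¹ (n := d ^ s - 1) (by omega)
  have hu0 : u ≠ 0 := by
    rintro rfl
    rw [zero_pow (by omega)] at hu
    exact inv_ne_zero ht0 hu.symm
  have hfix : (evalForms x.fst.rep)^[s] (u • x.snd.rep) = u • x.snd.rep := by
    rw [iterate_evalForms_smul, ht, smul_smul]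
    congr 1
    have : d ^ s = d ^ s - 1 + 1 := by omega
    rw [this, pow_succ, hu]
    field_simp
  have hker : (RingHom.ker (evalIter x.fst.rep (u • x.snd.rep))).IsPrime := RingHom.ker_isPrime _
  have hle : fixIdeal k n d s ≤ RingHom.ker (evalIter x.fst.rep (u • x.snd.rep)) := by
    rw [fixIdeal, Ideal.span_le]
    rintro _ ⟨j, rfl⟩
    rw [SetLike.mem_coe, RingHom.mem_ker, map_sub, evalIter_iterForm, hfix, evalIter_X, sub_self]
  obtain ⟨Q, hQ, hQle⟩ := Ideal.exists_minimalPrimes_le hle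
  refine ⟨Q, hQ, (1 : k) • x.fst.rep, smul_ne_zero one_ne_zero x.fst.rep_nonzero, u • x.snd.rep,
    smul_ne_zero hu0 x.snd.rep_nonzero, ?_, ?_, ?_⟩
  · rw [BiProj.of_smul x.fst.rep x.fst.rep_nonzero x.snd.rep x.snd.rep_nonzero one_ne_zero hu0,
      BiProj.of_rep]
  · rwa [one_smul]
  · rw [one_smul]
    exact fun q hq => hQle hq

theorem mem_of_forall_endLocus [IsAlgClosed k] (hd : d ≠ 0) {s : ℕ} (hs : s ≠ 0)
    (Q : Ideal (MvPolynomial (Fin (n + 1)) (MvPolynomial (CoeffIdx n d) k))) [Q.IsPrime]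
    (hne : (endLocus Q).Nonempty)
    {h : MvPolynomial (Fin (n + 1)) (MvPolynomial (CoeffIdx n d) k)}
    (hh : ∀ c w, w ≠ 0 → (∀ v, v ≠ 0 → evalForms c v ≠ 0) → (∀ q ∈ Q, evalIter c w q = 0) →
      evalIter c w h = 0) : h ∈ Q := by
  obtain ⟨_, c₀, -, w₀, hw₀, -, hf₀, hQ₀⟩ := hne
  obtain ⟨D, r, hr, hD⟩ := exists_C_mul_mem_span_iterForm hf₀ s
  obtain ⟨i, hi⟩ := Function.ne_iff.1 hw₀
  -- The factor `r X_i` kills the zeros of `Q` with `w = 0` or outside the endomorphisms; it is not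
  -- in `Q`, being nonzero at the given point of the locus.
  have hprod : h * (C r * X i) ∈ Q := by
    refine mem_of_forall_evalIter_eq_zero Q fun c w hcw => ?_
    rw [map_mul, map_mul, evalIter_C, evalIter_X]
    by_cases hrc : eval c r = 0
    · rw [hrc, zero_mul, mul_zero]
    by_cases hw : w = 0
    · rw [hw, Pi.zero_apply, mul_zero, mul_zero]
    rw [hh c w hw (evalForms_ne_zero_of_C_mul_mem_span hd hs hD hrc) hcw, zero_mul]
  refine (Ideal.IsPrime.mem_or_mem ‹_› hprod).resolve_right fun h1 => ?_
  have := hQ₀ _ h1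
  rw [map_mul, evalIter_C, evalIter_X] at this
  exact mul_ne_zero hr hi this

theorem isPreirreducible_endLocus [IsAlgClosed k] (hd : d ≠ 0) {s : ℕ} (hs : s ≠ 0)
    (Q : Ideal (MvPolynomial (Fin (n + 1)) (MvPolynomial (CoeffIdx n d) k))) [Q.IsPrime] :
    IsPreirreducible (endLocus Q) := by
  rw [isPreirreducible_iff_isClosed_union_isClosed]
  intro Z₁ Z₂ hZ₁ hZ₂ hsub
  by_contra! hcon
  obtain ⟨T₁, -, hT₁⟩ := exists_evalIter_of_isClosed hZ₁
  obtain ⟨T₂, -, hT₂⟩ := exists_evalIter_of_isClosed hZ₂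
  obtain ⟨h₁, h₂⟩ := hcon
  obtain ⟨x₁, hx₁, hn₁⟩ := Set.not_subset.1 h₁
  obtain ⟨x₂, hx₂, hn₂⟩ := Set.not_subset.1 h₂
  have hne : (endLocus Q).Nonempty := ⟨x₁, hx₁⟩
  obtain ⟨c₁, hc₁, w₁, hw₁, rfl, -, hQ₁⟩ := hx₁
  obtain ⟨c₂, hc₂, w₂, hw₂, rfl, -, hQ₂⟩ := hx₂
  rw [hT₁] at hn₁
  rw [hT₂] at hn₂
  push Not at hn₁ hn₂
  obtain ⟨p₁, hp₁, hne₁⟩ := hn₁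
  obtain ⟨p₂, hp₂, hne₂⟩ := hn₂
  have hmem : p₁ * p₂ ∈ Q := by
    refine mem_of_forall_endLocus hd hs Q hne fun c w hw hf hcw => ?_
    rw [map_mul]
    have hc := ne_zero_of_evalForms_ne_zero hf
    rcases hsub ⟨c, hc, w, hw, rfl, hf, hcw⟩ with h | h
    · rw [(hT₁ c hc w hw).1 h p₁ hp₁, zero_mul]
    · rw [(hT₂ c hc w hw).1 h p₂ hp₂, mul_zero]
  rcases Ideal.IsPrime.mem_or_mem ‹_› hmem with h | h
  · exact hne₁ (hQ₁ _ h)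
  · exact hne₂ (hQ₂ _ h)

/-- The zero locus of a minimal prime of the fixed point ideal dominates the space of
endomorphisms. -/
theorem eq_univ_of_fst_image_endLocus_subset [IsAlgClosed k] (hd : 2 ≤ d) {s : ℕ} (hs : s ≠ 0)
    {Q : Ideal (MvPolynomial (Fin (n + 1)) (MvPolynomial (CoeffIdx n d) k))}
    (hQ : Q ∈ (fixIdeal k n d s).minimalPrimes) (hne : (endLocus Q).Nonempty)
    {K : Set (ℙ k (CoeffIdx n d → k))} (hK : IsClosed K) (hsub : BiProj.fst '' endLocus Q ⊆ K) :
    K = Set.univ := by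
  have hprime : Q.IsPrime := hQ.1.1
  have hbot : Q.comap C = ⊥ := by
    obtain ⟨_, c, -, w, -, -, hf, hcw⟩ := id hne
    obtain ⟨D, r, hr, hD⟩ := exists_C_mul_mem_span_iterForm hf s
    exact comap_C_eq_bot_of_mem_minimalPrimes (hd.trans (Nat.le_self_pow hs d))
      (iterForm_isHomogeneous s) hD hQ fun h => hr (by simpa using hcw _ h)
  obtain ⟨S, hS, rfl⟩ := (isClosed_proj_iff K).1 hK
  refine Set.eq_univ_of_forall fun P p hp => ?_
  obtain ⟨a, ha⟩ := hS p hp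
  have hmem : C p ∈ Q := by
    refine mem_of_forall_endLocus (by omega) hs Q hne fun c w hw hf hcw => ?_
    have hc := ne_zero_of_evalForms_ne_zero hf
    have := hsub ⟨_, ⟨c, hc, w, hw, rfl, hf, hcw⟩, rfl⟩ p hp
    rw [evalIter_C]
    exact (eval_rep_mk_eq_zero_iff ha c hc).1 this
  have h0 : p ∈ Q.comap C := hmem
  rw [hbot, Ideal.mem_bot] at h0
  rw [h0, map_zero]

/-- The projection from the incidence variety to the space of endomorphisms. -/
def incidenceProj (s : ℕ) (x : Incidence k n d s) : EndSpace k n d :=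
  ⟨x.1.fst, x.2.1⟩

theorem continuous_incidenceProj [Infinite k] (s : ℕ) :
    Continuous (incidenceProj (k := k) (n := n) (d := d) s) :=
  (continuous_biProj_fst.comp continuous_subtype_val).subtype_mk _

theorem isClosedMap_incidenceProj [IsAlgClosed k] (s : ℕ) :
    IsClosedMap (incidenceProj (k := k) (n := n) (d := d) s) := by
  have := IsAlgClosed.instInfinite (K := k)
  intro Z hZ
  obtain ⟨C, hC, rfl⟩ := isClosed_induced_iff.1 hZ
  obtain ⟨K, hK, hinc⟩ := exists_isClosed_incidence (k := k) (n := n) (d := d) s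
  refine isClosed_induced_iff.2 ⟨_, isClosedMap_biProj_fst _ (hC.inter hK), ?_⟩
  ext f
  constructor
  · rintro ⟨x, ⟨hxC, hxK⟩, hxf⟩
    have hxE : x ∈ EndTimesProj k n d := by
      change x.fst ∈ EndSpace k n d
      rw [hxf]
      exact f.2
    exact ⟨⟨x, hinc ▸ ⟨hxK, hxE⟩⟩, hxC, Subtype.ext hxf⟩
  · rintro ⟨x, hxC, rfl⟩
    have hx := hinc.subset x.2
    exact ⟨x.1, ⟨hxC, hx.1⟩, rfl⟩

/-- Finitely many irreducible loci cover, so `Z` lies in the closure of one of them and, being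
maximal, contains that locus. Its image is closed and contains a dense set. -/
theorem incidenceProj_image_eq_univ [IsAlgClosed k] (hd : 2 ≤ d) {s : ℕ} (hs : s ≠ 0)
    {Z : Set (Incidence k n d s)} (hZ : Z ∈ irreducibleComponents (Incidence k n d s)) :
    incidenceProj s '' Z = Set.univ := by
  classical
  let E (Q : Ideal (MvPolynomial (Fin (n + 1)) (MvPolynomial (CoeffIdx n d) k))) :
    Set (Incidence k n d s) := Subtype.val ⁻¹' endLocus Q
  have hfin := Ideal.finite_minimalPrimes_of_isNoetherianRing _ (fixIdeal k n d s)
  have hfin' : ((fun Q => closure (E Q)) '' {Q | Q ∈ (fixIdeal k n d s).minimalPrimes}).Finite :=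
    hfin.image _
  obtain ⟨V, hV, hZV⟩ := isIrreducible_iff_sUnion_isClosed.1 hZ.1 hfin'.toFinset (by
    intro V hV
    obtain ⟨Q, -, rfl⟩ := hfin'.mem_toFinset.1 hV
    exact isClosed_closure) (by
    intro x _
    obtain ⟨Q, hQ, hxQ⟩ := exists_mem_endLocus_of_mem_incidence hd hs x.2
    exact ⟨closure (E Q), hfin'.mem_toFinset.2 ⟨Q, hQ, rfl⟩, subset_closure hxQ⟩)
  obtain ⟨Q, hQ, rfl⟩ := hfin'.mem_toFinset.1 hV
  have hQ' : Q ∈ (fixIdeal k n d s).minimalPrimes := hQ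
  have hprime : Q.IsPrime := hQ'.1.1
  have hne : (E Q).Nonempty := closure_nonempty_iff.1 (hZ.1.nonempty.mono hZV)
  have hirr : IsIrreducible (E Q) := by
    refine ⟨hne, isPreirreducible_iff_isClosed_union_isClosed.2 fun Z₁ Z₂ hZ₁ hZ₂ hsub => ?_⟩
    obtain ⟨C₁, hC₁, rfl⟩ := isClosed_induced_iff.1 hZ₁
    obtain ⟨C₂, hC₂, rfl⟩ := isClosed_induced_iff.1 hZ₂
    rcases isPreirreducible_iff_isClosed_union_isClosed.1
      (isPreirreducible_endLocus (by omega) hs Q) C₁ C₂ hC₁ hC₂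
      (fun x hx => hsub (a := ⟨x, endLocus_subset_incidence hQ'.1.2 hx⟩) hx) with h | h
    · exact Or.inl fun x hx => h hx
    · exact Or.inr fun x hx => h hx
  have hEZ : E Q ⊆ Z := subset_closure.trans (hZ.2 hirr.closure hZV)
  have hclosed : IsClosed (incidenceProj s '' Z) :=
    isClosedMap_incidenceProj s _ (isClosed_of_mem_irreducibleComponents Z hZ)
  obtain ⟨K, hK, hKZ⟩ := isClosed_induced_iff.1 hclosed
  have hKuniv : K = Set.univ := by
    obtain ⟨x, hx⟩ := hne
    refine eq_univ_of_fst_image_endLocus_subset hd hs hQ' ⟨x.1, hx⟩ hK ?_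
    rintro _ ⟨x, hx, rfl⟩
    have : incidenceProj s ⟨x, endLocus_subset_incidence hQ'.1.2 hx⟩ ∈ incidenceProj s '' Z :=
      ⟨_, hEZ hx, rfl⟩
    rwa [← hKZ] at this
  rw [← hKZ, hKuniv, Set.preimage_univ]

end IncidenceComponents

/-! ### Nested irreducible sets have different images, and the dimension bounds. -/

section Fibres

open MvPolynomial

theorem aeval_smul_of_isHomogeneous {R κ L : Type*} [CommRing R] [Field L] [Algebra R L]
    {p : MvPolynomial κ R} {a : ℕ} (hp : p.IsHomogeneous a) (u : L) (x : κ → L) :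
    aeval (u • x) p = u ^ a * aeval x p := by
  rw [aeval_def, aeval_def, eval₂_eq_eval_map, eval₂_eq_eval_map,
    eval_smul_of_isHomogeneous (hp.map _)]

theorem isAlgebraic_range_aeval {R κ L : Type*} [CommRing R] [Field L] [Algebra R L] {y : κ → L}
    (hy : ∀ j, IsAlgebraic (algebraMap R L).range (y j)) (p : MvPolynomial κ R) :
    IsAlgebraic (algebraMap R L).range (aeval y p) := by
  induction p using MvPolynomial.induction_on with
  | C a =>
    rw [aeval_C]
    exact isAlgebraic_algebraMap (⟨algebraMap R L a, a, rfl⟩ : (algebraMap R L).range)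
  | add p q hp hq => rw [map_add]; exact hp.add hq
  | mul_X p i hp => rw [map_mul, aeval_X]; exact hp.mul (hy i)

/-- The ratio of a form to a power of a variable, at a point over an algebraically closed field
that is fixed up to a scalar by forms of degree at least two, is a root of a polynomial with
nonzero constant coefficient over the ring of definition. -/
theorem exists_sum_eq_zero_of_aeval_eq_smul {R κ L : Type*} [CommRing R] [Finite κ] [Field L]
    [IsAlgClosed L] [Algebra R L] {G : κ → MvPolynomial κ R} {e D : ℕ} (he : 2 ≤ e)
    (hG : ∀ j, (G j).IsHomogeneous e) {r : R} (hr : algebraMap R L r ≠ 0)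
    (hD : ∀ h : MvPolynomial κ R, h.IsHomogeneous D → C r * h ∈ Ideal.span (Set.range G))
    {x : κ → L} {t : L} (hx : ∀ j, aeval x (G j) = t * x j) {i : κ} (hi : x i ≠ 0)
    {p : MvPolynomial κ R} {b : ℕ} (hp : p.IsHomogeneous b) (hpx : aeval x p ≠ 0) :
    ∃ f : Polynomial R, algebraMap R L (f.coeff 0) ≠ 0 ∧
      aeval x (∑ m ∈ Finset.range (f.natDegree + 1),
        C (f.coeff m) * p ^ m * X i ^ (b * (f.natDegree - m))) = 0 := by
  -- If `t = 0`, then `x` is a common zero of the `G j`, against `r x_i^D ≠ 0`.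
  have ht : t ≠ 0 := by
    rintro rfl
    have hle : Ideal.span (Set.range G) ≤ RingHom.ker (aeval (R := R) x) := by
      rw [Ideal.span_le]
      rintro _ ⟨j, rfl⟩
      rw [SetLike.mem_coe, RingHom.mem_ker, hx, zero_mul]
    have h1 := hle (hD _ (isHomogeneous_X_pow i D))
    rw [RingHom.mem_ker, map_mul, map_pow, aeval_X, aeval_C] at h1
    exact mul_ne_zero hr (pow_ne_zero _ hi) h1
  obtain ⟨u, hu⟩ := IsAlgClosed.exists_pow_nat_eq t⁻¹ (n := e - 1) (by omega)
  have hu0 : u ≠ 0 := by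
    rintro rfl
    rw [zero_pow (by omega)] at hu
    exact inv_ne_zero ht hu.symm
  have hy : ∀ j, aeval (u • x) (G j) = (u • x) j := by
    intro j
    have hee : e = e - 1 + 1 := by omega
    rw [aeval_smul_of_isHomogeneous (hG j), hx, hee, pow_succ, hu, Pi.smul_apply, smul_eq_mul]
    field_simp
  have halg := isAlgebraic_range_of_aeval_eq_self he hG hr hD hy
  -- The ratio has degree zero, so it is the same at `x` and at the rescaled point, whose
  -- coordinates are algebraic.
  have hθ : IsAlgebraic (algebraMap R L).range (aeval x p * (x i ^ b)⁻¹) := by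
    have h1 := (isAlgebraic_range_aeval halg p).mul ((halg i).pow b).inv
    have h2 : aeval (u • x) p * ((u • x) i ^ b)⁻¹ = aeval x p * (x i ^ b)⁻¹ := by
      rw [aeval_smul_of_isHomogeneous hp, Pi.smul_apply, smul_eq_mul, mul_pow, mul_inv,
        mul_mul_mul_comm, mul_inv_cancel₀ (pow_ne_zero b hu0), one_mul]
    rwa [h2] at h1
  obtain ⟨f, hf0, hf⟩ := exists_polynomial_of_isAlgebraic_range
    (mul_ne_zero hpx (inv_ne_zero (pow_ne_zero _ hi))) hθ
  refine ⟨f, hf0, ?_⟩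
  rw [Polynomial.aeval_eq_sum_range] at hf
  rw [← mul_zero (x i ^ (b * f.natDegree)), ← hf, map_sum, Finset.mul_sum]
  refine Finset.sum_congr rfl fun m hm => ?_
  have hm' : b * f.natDegree = b * m + b * (f.natDegree - m) := by
    rw [← mul_add, Nat.add_sub_cancel' (by simpa [Nat.lt_succ_iff] using hm)]
  rw [map_mul, map_mul, map_pow, map_pow, aeval_X, aeval_C, Algebra.smul_def, mul_pow, inv_pow,
    ← pow_mul, hm', pow_add]
  have := pow_ne_zero (b * m) hi
  field_simp

variable {k : Type*} [Field k] {n d : ℕ}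

/-- Vanishing of `a` on the cone is a closed condition on the endomorphism alone, so it passes to
the closure of the image. -/
theorem C_mem_coneIdeal_of_image_subset_closure [Infinite k] {s : ℕ}
    {Z Z' : Set (Incidence k n d s)}
    (hsub : incidenceProj s '' Z' ⊆ closure (incidenceProj s '' Z))
    {a : MvPolynomial (CoeffIdx n d) k} (ha : C a ∈ coneIdeal (Subtype.val '' Z)) :
    C a ∈ coneIdeal (Subtype.val '' Z') := by
  have hcl : IsClosed {f : EndSpace k n d | ∀ t : k, t ≠ 0 → eval (t • f.1.rep) a = 0} :=
    (isClosed_setOf_forall_eval_smul_eq_zero a).preimage continuous_subtype_val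
  have h1 : incidenceProj s '' Z ⊆
      {f : EndSpace k n d | ∀ t : k, t ≠ 0 → eval (t • f.1.rep) a = 0} := by
    rintro _ ⟨x, hx, rfl⟩ t ht
    have := ha (t • x.1.fst.rep) (smul_ne_zero ht x.1.fst.rep_nonzero)
      ((1 : k) • x.1.snd.rep) (smul_ne_zero one_ne_zero x.1.snd.rep_nonzero) (by
        rw [BiProj.of_smul x.1.fst.rep x.1.fst.rep_nonzero x.1.snd.rep x.1.snd.rep_nonzero ht
          one_ne_zero, BiProj.of_rep]
        exact ⟨x, hx, rfl⟩)
    rwa [evalIter_C] at this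
  rw [mem_coneIdeal_iff_scaleHom]
  rintro _ ⟨x, hx, rfl⟩
  refine scaleHom_eq_zero fun t u ht _ => ?_
  rw [eval_iterEquiv_symm, evalIter_C]
  exact closure_minimal h1 hcl (hsub ⟨x, hx, rfl⟩) t ht

/-- Take `p` vanishing on `Z` but not on `Z'`. At the generic point of `Z'` the ratio `p / X_i^b`
satisfies a polynomial relation over the coefficient ring with nonzero constant term. On `Z` the
relation reduces to that term, which therefore vanishes on `Z`; equal closures would make it vanish
on `Z'` too. -/
theorem closure_incidenceProj_image_ne [IsAlgClosed k] (hd : 2 ≤ d) {s : ℕ} (hs : s ≠ 0)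
    {Z Z' : Set (Incidence k n d s)} (hZ : IsIrreducible Z) (hZc : IsClosed Z)
    (hZ' : IsIrreducible Z') (hlt : Z ⊂ Z') :
    closure (incidenceProj s '' Z) ≠ closure (incidenceProj s '' Z') := by
  have := IsAlgClosed.instInfinite (K := k)
  intro heq
  have hZ₁ : IsIrreducible (Subtype.val '' Z : Set (BiProj k (CoeffIdx n d) (Fin (n + 1)))) :=
    hZ.image _ continuous_subtype_val.continuousOn
  have hZ₁' : IsIrreducible (Subtype.val '' Z' : Set (BiProj k (CoeffIdx n d) (Fin (n + 1)))) :=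
    hZ'.image _ continuous_subtype_val.continuousOn
  set P := coneIdeal (Subtype.val '' Z')
  set P₁ := coneIdeal (Subtype.val '' Z)
  have hPp : P.IsPrime := coneIdeal_isPrime hZ₁'
  have hPp₁ : P₁.IsPrime := coneIdeal_isPrime hZ₁
  obtain ⟨K, hK, rfl⟩ := isClosed_induced_iff.1 hZc
  obtain ⟨T, hThom, hT⟩ := exists_evalIter_of_isClosed hK
  obtain ⟨p, hpT, hpP⟩ : ∃ p ∈ T, p ∉ P := by
    by_contra! hcon
    refine hlt.2 fun x hx => ?_
    change x.1 ∈ K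
    rw [← BiProj.of_rep x.1, hT]
    exact fun p hp => hcon p hp _ x.1.fst.rep_nonzero _ x.1.snd.rep_nonzero
      (by rw [BiProj.of_rep]; exact ⟨x, hx, rfl⟩)
  obtain ⟨b, hb⟩ := hThom p hpT
  have hpP₁ : ∀ c hc w hw, BiProj.of c hc w hw ∈ Subtype.val ''
      (Subtype.val ⁻¹' K : Set (Incidence k n d s)) → evalIter c w p = 0 := by
    rintro c hc w hw ⟨x, hx, hxe⟩
    refine (hT c hc w hw).1 ?_ p hpT
    rw [← hxe]
    exact hx
  obtain ⟨x₀, hx₀⟩ := hZ.nonempty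
  have hmem₀ : BiProj.of x₀.1.fst.rep x₀.1.fst.rep_nonzero x₀.1.snd.rep x₀.1.snd.rep_nonzero ∈
      Subtype.val '' (Subtype.val ⁻¹' K : Set (Incidence k n d s)) := by
    rw [BiProj.of_rep]
    exact ⟨x₀, hx₀, rfl⟩
  have hle : P ≤ P₁ := fun q hq c hc w hw h => hq c hc w hw (Set.image_mono hlt.1 h)
  have hf₀ : ∀ v, v ≠ 0 → evalForms x₀.1.fst.rep v ≠ 0 := by
    have := x₀.2
    rw [← BiProj.of_rep x₀.1] at this
    exact (of_mem_incidence_iff.1 this).1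
  obtain ⟨D, r, hr, hD⟩ := exists_C_mul_mem_span_iterForm hf₀ s
  obtain ⟨i, hi⟩ := Function.ne_iff.1 x₀.1.snd.rep_nonzero
  have hrP : C r ∉ P := fun h => hr (by
    simpa using hle h _ x₀.1.fst.rep_nonzero _ x₀.1.snd.rep_nonzero hmem₀)
  have hXP₁ : X i ∉ P₁ := fun h => hi (by
    simpa using h _ x₀.1.fst.rep_nonzero _ x₀.1.snd.rep_nonzero hmem₀)
  -- The generic point of the cone over `Z'`, with coordinates `ψ (X j)`; algebraic closedness
  -- permits the rescaling to a fixed vector.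
  let L := AlgebraicClosure P.ResidueField
  let ψ : MvPolynomial (Fin (n + 1)) (MvPolynomial (CoeffIdx n d) k) →+* L :=
    (algebraMap P.ResidueField L).comp (algebraMap _ P.ResidueField)
  have hψ : ∀ q, ψ q = 0 ↔ q ∈ P := fun q => by
    simp only [ψ, RingHom.comp_apply, map_eq_zero]
    exact Ideal.algebraMap_residueField_eq_zero
  let : Algebra (MvPolynomial (CoeffIdx n d) k) L := (ψ.comp C).toAlgebra
  have hmap : ∀ a, algebraMap (MvPolynomial (CoeffIdx n d) k) L a = ψ (C a) := fun a => rfl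
  have haeval : ∀ q, aeval (fun j => ψ (X j)) q = ψ q := by
    intro q
    induction q using MvPolynomial.induction_on with
    | C a => rw [aeval_C, hmap]
    | add p q hp hq => rw [map_add, map_add, hp, hq]
    | mul_X p i hp => rw [map_mul, map_mul, aeval_X, hp]
  have hXi : ψ (X i) ≠ 0 := by
    rw [Ne, hψ]
    exact fun h => hXP₁ (hle h)
  have hminor : ∀ j, ψ (X i) * ψ (iterForm k n d s j) = ψ (X j) * ψ (iterForm k n d s i) := by
    intro j
    rw [← sub_eq_zero, ← map_mul, ← map_mul, ← map_sub, hψ]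
    rintro c hc w hw ⟨x, hx, hxe⟩
    have hx2 := x.2
    rw [hxe, of_mem_incidence_iff] at hx2
    obtain ⟨-, t, ht⟩ := hx2
    simp only [map_sub, map_mul, evalIter_X, evalIter_iterForm, ht, Pi.smul_apply, smul_eq_mul]
    ring
  obtain ⟨f, hf0, hf⟩ := exists_sum_eq_zero_of_aeval_eq_smul (L := L)
    (hd.trans (Nat.le_self_pow hs d)) (iterForm_isHomogeneous s) (r := r)
    (by rwa [hmap, Ne, hψ]) hD (x := fun j => ψ (X j))
    (t := ψ (iterForm k n d s i) / ψ (X i))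
    (fun j => by
      rw [haeval]
      rw [div_mul_eq_mul_div, eq_div_iff hXi, mul_comm, hminor, mul_comm]) hXi hb
    (by rwa [haeval, Ne, hψ])
  rw [haeval, hψ] at hf
  -- Every term with `m ≥ 1` contains a factor `p`, which vanishes on `Z`.
  have hprod : C (f.coeff 0) * X i ^ (b * f.natDegree) ∈ P₁ := by
    intro c hc w hw h
    have h1 := hle hf c hc w hw h
    rw [map_sum, Finset.sum_eq_single 0] at h1
    · simpa using h1
    · intro m _ hm
      rw [map_mul, map_mul, map_pow, hpP₁ c hc w hw h, zero_pow hm, mul_zero, zero_mul]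
    · simp
  have hC : C (f.coeff 0) ∈ P₁ := (hPp₁.mem_or_mem hprod).resolve_right fun h =>
    hXP₁ (hPp₁.mem_of_pow_mem _ h)
  refine hf0 ?_
  rw [hmap, hψ]
  exact C_mem_coneIdeal_of_image_subset_closure (heq ▸ subset_closure) hC

theorem incidence_nonempty (k : Type*) [Field k] (n d s : ℕ) (hd : d ≠ 0) :
    (Incidence k n d s).Nonempty := by
  classical
  -- The power map `x_i ↦ x_i^d`, which fixes `(1 : … : 1)`.
  let c : CoeffIdx n d → k := fun x => if x.2.1 = Finsupp.single x.1 d then 1 else 0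
  have hc : ∀ w, evalForms c w = fun i => w i ^ d := by
    intro w
    funext i
    have hmem : Finsupp.single i d ∈ Finset.finsuppAntidiag (Finset.univ : Finset (Fin (n + 1))) d :=
      Finset.mem_finsuppAntidiag.2 ⟨by simp [Finsupp.single_apply], by simp⟩
    rw [evalForms, form, map_sum, Finset.sum_eq_single (⟨_, hmem⟩ : Exponents n d)]
    · simp [c, eval_monomial]
    · intro α _ hα
      have : α.1 ≠ Finsupp.single i d := fun h => hα (Subtype.ext h)
      simp [c, this]
    · exact fun h => absurd (Finset.mem_univ _) h
  have hf : ∀ v, v ≠ 0 → evalForms c v ≠ 0 := by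
    intro v hv h
    refine hv (funext fun i => ?_)
    have := congrFun h i
    rw [hc] at this
    exact pow_eq_zero_iff hd |>.1 this
  refine ⟨BiProj.of c (ne_zero_of_evalForms_ne_zero hf) 1 one_ne_zero,
    of_mem_incidence_iff.2 ⟨hf, 1, ?_⟩⟩
  rw [one_smul]
  refine Function.iterate_fixed ?_ s
  rw [hc]
  funext i
  simp

theorem topologicalKrullDim_incidence_le [IsAlgClosed k] (hd : 2 ≤ d) {s : ℕ} (hs : s ≠ 0) :
    topologicalKrullDim (Incidence k n d s) ≤ topologicalKrullDim (EndSpace k n d) := by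
  have := IsAlgClosed.instInfinite (K := k)
  exact topologicalKrullDim_le_of_closure_image_ne (continuous_incidenceProj s)
    fun Z Z' hZ hZc hZ' _ hlt => closure_incidenceProj_image_ne hd hs hZ hZc hZ' hlt

theorem topologicalKrullDim_endSpace_le [IsAlgClosed k] (hd : 2 ≤ d) {s : ℕ} (hs : s ≠ 0)
    {Z : Set (Incidence k n d s)} (hZ : Z ∈ irreducibleComponents (Incidence k n d s)) :
    topologicalKrullDim (EndSpace k n d) ≤ topologicalKrullDim Z := by
  have := IsAlgClosed.instInfinite (K := k)
  have : TopologicalSpace.NoetherianSpace (BiProj k (CoeffIdx n d) (Fin (n + 1))) :=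
    noetherianSpace_biProj
  have : TopologicalSpace.NoetherianSpace (Incidence k n d s) :=
    Topology.IsInducing.subtypeVal.noetherianSpace
  have : TopologicalSpace.NoetherianSpace Z := Topology.IsInducing.subtypeVal.noetherianSpace
  refine topologicalKrullDim_le_of_isClosedMap_of_surjective
    (f := fun z : Z => incidenceProj s z.1)
    ((isClosedMap_incidenceProj s).comp
      (isClosed_of_mem_irreducibleComponents Z hZ).isClosedMap_subtype_val)
    ((continuous_incidenceProj s).comp continuous_subtype_val) fun f => ?_
  have hf : f ∈ incidenceProj s '' Z := by
    rw [incidenceProj_image_eq_univ hd hs hZ]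
    trivial
  obtain ⟨x, hx, rfl⟩ := hf
  exact ⟨⟨x, hx⟩, rfl⟩

end Fibres

end EndDyn

theorem mainTheorem7 {k : Type*} [Field k] [IsAlgClosed k] (n d s : ℕ)
    (hn : 1 ≤ n) (hd : 2 ≤ d) (hs : 1 ≤ s) :
    IsClosed {x : EndDyn.EndTimesProj k n d | x.1 ∈ EndDyn.Incidence k n d s} ∧
      EndDyn.IsPureOfDim (EndDyn.Incidence k n d s)
        (topologicalKrullDim (EndDyn.EndSpace k n d)) := by
  have := IsAlgClosed.instInfinite (K := k)
  have hs' : s ≠ 0 := by omega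
  have hcomp : ∀ Z ∈ irreducibleComponents (EndDyn.Incidence k n d s),
      topologicalKrullDim Z = topologicalKrullDim (EndDyn.EndSpace k n d) := fun Z hZ =>
    le_antisymm ((topologicalKrullDim_subspace_le _ Z).trans
      (EndDyn.topologicalKrullDim_incidence_le hd hs'))
      (EndDyn.topologicalKrullDim_endSpace_le hd hs' hZ)
  refine ⟨?_, le_antisymm (EndDyn.topologicalKrullDim_incidence_le hd hs') ?_, hcomp⟩
  · obtain ⟨K, hK, hinc⟩ := EndDyn.exists_isClosed_incidence (k := k) (n := n) (d := d) s
    refine isClosed_induced_iff.2 ⟨K, hK, ?_⟩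
    ext x
    simp only [hinc, Set.mem_preimage, Set.mem_ofPred_eq]
    exact ⟨fun h => ⟨h, x.2⟩, fun h => h.1⟩
  -- The lower bound for the total dimension is inherited from any one component, so a point is
  -- needed.
  · obtain ⟨x, hx⟩ := EndDyn.incidence_nonempty k n d s (by omega)
    have hZ := irreducibleComponent_mem_irreducibleComponents (⟨x, hx⟩ : EndDyn.Incidence k n d s)
    exact (hcomp _ hZ).ge.trans (topologicalKrullDim_subspace_le _ _)
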